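/- **Conventions.** Let $p$ be a prime. Subgroups of profinite groups are closed and homomorphisms between profinite groups are continuous. A *fusion system* on a finite $p$-group $S$ is a category whose objects are the subgroups of $S$ and whose morphisms are injective group homomorphisms, such that every homomorphism $P\to Q$ ($P,Q\le S$) induced by conjugation by an element of $S$ is a morphism, and every morphism is an isomorphism of the category followed by an inclusion. Let $\mathcal F$ and $\mathcal G$ be categories whose objects are the subgroups of profinite groups $S$ and $T$, respectively, and whose morphisms are homomorphisms. A *morphism* $\mathcal F\to\mathcal G$ is a homomorphism $\alpha:S\to T$ for which there is a functor $A:\mathcal F\to\mathcal G$ with $A(P)=\alpha(P)$ for all $P\le S$ and $A(\varphi)\circ\alpha|_P=\alpha\circ\varphi$ for all $\varphi\in\mathrm{Hom}_{\mathcal F}(P,Q)$; it is an isomorphism if it has an inverse morphism. Let $(\mathcal F_i)_{i\in I}$ be an inverse system of fusion systems on finite $p$-groups $S_i$, indexed by a directed partially ordered set $I$. Let $S=\varprojlim S_i$, with projections $f_i:S\to S_i$. The *inverse limit* $\varprojlim\mathcal F_i$ is the category with objects the subgroups of the pro-$p$ group $S$ and with $\mathrm{Hom}(P,Q)=\varprojlim_i\mathrm{Hom}_{\mathcal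 F_i}(f_i(P),f_i(Q))$, whose elements are regarded as homomorphisms $P\to Q$. A *pro-fusion system* on a pro-$p$ group $S$ is a category of subgroups of $S$ isomorphic to such an inverse limit; $\mathrm{Aut}_{\mathcal F}(P)$ is then naturally a profinite group. Let $\mathcal F$ be a pro-fusion system on $S$ and $Q\le S$ (finite $p$-groups are included). Let $\mathrm{Aut}_S(Q)\le\mathrm{Aut}_{\mathcal F}(Q)$ be the group of automorphisms of $Q$ induced by conjugation by elements of $N_S(Q)$. * $Q$ is *receptive* if for every $R\le S$ and every isomorphism $\varphi:R\to Q$ of $\mathcal F$ there is a morphism $\tilde\varphi:N_\varphi\to N_S(Q)$ of $\mathcal F$ with $\tilde\varphi|_R=\varphi$, where $$N_\varphi=\{x\in N_S(R)\mid \exists\, y\in N_S(Q)\ \forall u\in R:\ \varphi(xux^{-1})=y\varphi(u)y^{-1}\}.$$ * $Q$ is *fully automized* if $\mathrm{Aut}_S(Q)$ is a Sylow pro-$p$ subgroup of $\mathrm{Aut}_{\mathcal F}(Q)$. * $\mathcal F$ is *saturated* if every $\mathcal F$-isomorphism class of subgroups of $S$ contains a subgroup that is both receptive and fully automized. A pro-fusion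 system is *countably based* if it is isomorphic to an inverse limit of fusion systems on finite $p$-groups indexed by $\mathbb N$ with its usual order, and *pro-saturated* if it is isomorphic to an inverse limit, over some directed set, of saturated fusion systems on finite $p$-groups. **Theorem.** Let $\mathcal F$ be a pro-fusion system on a pro-$p$ group $S$. If $\mathcal F$ is countably based and pro-saturated, then $\mathcal F$ is saturated. -/

import Mathlib

universe u v w x

/-- The image of a closed subgroup of a compact group under a continuous homomorphism to a
Hausdorff group, as a closed subgroup. -/
def ClosedSubgroup.image {S : Type u} {T : Type v} [Group S] [TopologicalSpace S] [CompactSpace S]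
    [Group T] [TopologicalSpace T] [T2Space T] (α : S →ₜ* T) (P : ClosedSubgroup S) :
    ClosedSubgroup T where
  toSubgroup := P.toSubgroup.map α.toMonoidHom
  isClosed' := (P.isClosed'.isCompact.image α.continuous_toFun).isClosed

theorem ClosedSubgroup.apply_mem_image {S : Type u} {T : Type v} [Group S] [TopologicalSpace S]
    [CompactSpace S] [Group T] [TopologicalSpace T] [T2Space T] (α : S →ₜ* T)
    (P : ClosedSubgroup S) (a : P) : α a ∈ P.image α :=
  ⟨a, a.2, rfl⟩

/-- The normalizer `N_S(Q)` of a closed subgroup, as a closed subgroup. -/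
def ClosedSubgroup.normalizer {S : Type u} [Group S] [TopologicalSpace S] [IsTopologicalGroup S]
    (Q : ClosedSubgroup S) : ClosedSubgroup S where
  toSubgroup := Subgroup.normalizer (Q : Set S)
  isClosed' := by
    have h : (Subgroup.normalizer (Q : Set S)).carrier =
        (⋂ n ∈ (Q : Set S), {g : S | g * n * g⁻¹ ∈ (Q : Set S)}) ∩
        (⋂ n ∈ (Q : Set S), {g : S | g⁻¹ * n * g ∈ (Q : Set S)}) := by
      ext g
      simp only [Set.mem_inter_iff, Set.mem_iInter, Set.mem_ofPred_eq]
      constructor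
      · intro hg
        refine ⟨fun n hn => (hg n).1 hn, fun n hn => (hg _).2 ?_⟩
        simpa [mul_assoc] using hn
      · rintro ⟨h1, h2⟩ n
        refine ⟨h1 n, fun hn => ?_⟩
        simpa [mul_assoc] using h2 _ hn
    rw [h]
    have hQ : IsClosed (Q : Set S) := Q.isClosed'
    refine (isClosed_biInter fun n _ => ?_).inter (isClosed_biInter fun n _ => ?_)
    · exact hQ.preimage (by fun_prop)
    · exact hQ.preimage (by fun_prop)

/-- A category whose objects are the closed subgroups of `S` and whose morphisms are continuous
group homomorphisms between them. If `S` is discrete, this involves all subgroups of `S` and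
all homomorphisms. -/
structure SubgroupCategory (S : Type u) [Group S] [TopologicalSpace S] where
  Hom : ∀ P Q : ClosedSubgroup S, Set (P →ₜ* Q)
  id_mem : ∀ P : ClosedSubgroup S, ContinuousMonoidHom.id P ∈ Hom P P
  comp_mem : ∀ {P Q R : ClosedSubgroup S} {φ : P →ₜ* Q} {ψ : Q →ₜ* R},
    φ ∈ Hom P Q → ψ ∈ Hom Q R → ψ.comp φ ∈ Hom P R

namespace SubgroupCategory

section Basic

variable {S : Type u} [Group S] [TopologicalSpace S] (F : SubgroupCategory S)

/-- `φ` is an isomorphism of the category `F`: it is a morphism of `F` with an inverse in `F`. -/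
def IsIso {P Q : ClosedSubgroup S} (φ : P →ₜ* Q) : Prop :=
  φ ∈ F.Hom P Q ∧ ∃ ψ ∈ F.Hom Q P, (∀ a, ψ (φ a) = a) ∧ ∀ b, φ (ψ b) = b

/-- The axioms of a fusion system on `S` (used when `S` is a finite, discrete `p`-group). -/
structure IsFusionSystem : Prop where
  injective : ∀ {P Q : ClosedSubgroup S} {φ : P →ₜ* Q}, φ ∈ F.Hom P Q → Function.Injective φ
  conj_mem : ∀ {P Q : ClosedSubgroup S} (φ : P →ₜ* Q) (s : S),
    (∀ a : P, (φ a : S) = s * a * s⁻¹) → φ ∈ F.Hom P Q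
  factor : ∀ {P Q : ClosedSubgroup S} {φ : P →ₜ* Q}, φ ∈ F.Hom P Q →
    ∃ R ≤ Q, ∃ ψ : P →ₜ* R, F.IsIso ψ ∧ ∀ a : P, (ψ a : S) = φ a

/-- The group `Aut_F(P)` of automorphisms of `P` in the category `F`. -/
def aut (P : ClosedSubgroup S) : Subgroup (MulAut P) where
  carrier := {e | (∃ φ ∈ F.Hom P P, ∀ a, φ a = e a) ∧ ∃ ψ ∈ F.Hom P P, ∀ a, ψ a = e⁻¹ a}
  one_mem' := ⟨⟨_, F.id_mem P, fun _ => rfl⟩, ⟨_, F.id_mem P, fun _ => rfl⟩⟩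
  mul_mem' := by
    rintro e f ⟨⟨φ, hφ, hφe⟩, ψ, hψ, hψe⟩ ⟨⟨φ', hφ', hφe'⟩, ψ', hψ', hψe'⟩
    refine ⟨⟨_, F.comp_mem hφ' hφ, fun a => ?_⟩, _, F.comp_mem hψ hψ', fun a => ?_⟩
    · change φ (φ' a) = e (f a)
      rw [hφe', hφe]
    · rw [mul_inv_rev]
      change ψ' (ψ a) = f⁻¹ (e⁻¹ a)
      rw [hψe, hψe']
  inv_mem' := by
    rintro e ⟨h1, h2⟩
    exact ⟨h2, by rwa [inv_inv]⟩

theorem continuous_aut {P : ClosedSubgroup S} (e : F.aut P) :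
    Continuous (fun a : P => (e : MulAut P) a) := by
  obtain ⟨φ, -, h⟩ := e.2.1
  exact φ.continuous_toFun.congr h

/-- An element of `Aut_F(P)` as a continuous map. -/
def autToMap {P : ClosedSubgroup S} (e : F.aut P) : C(P, P) :=
  ⟨fun a => (e : MulAut P) a, F.continuous_aut e⟩

/-- The natural topology of `Aut_F(P)`, that of uniform convergence on `P`. When `F` is the
inverse limit of categories `F i` on finite groups, a base of neighbourhoods of `1` is formed by
the automorphisms that induce the identity in `F i`, so this is the profinite topology of the
inverse limit of the finite groups of automorphisms in the `F i`. -/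
instance instTopologicalSpaceAut (P : ClosedSubgroup S) : TopologicalSpace (F.aut P) :=
  TopologicalSpace.induced F.autToMap ContinuousMap.compactOpen

/-- `Aut_S(Q)`: the automorphisms in `Aut_F(Q)` induced by conjugation with elements of
`N_S(Q)`. -/
def autInner (Q : ClosedSubgroup S) : Subgroup (F.aut Q) where
  carrier := {e | ∃ s ∈ Subgroup.normalizer (Q : Set S),
    ∀ a : Q, ((e : MulAut Q) a : S) = s * a * s⁻¹}
  one_mem' := ⟨1, one_mem _, fun a => by simp⟩
  mul_mem' := by
    rintro e f ⟨s, hs, hse⟩ ⟨t, ht, htf⟩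
    refine ⟨s * t, mul_mem hs ht, fun a => ?_⟩
    change (((e : MulAut Q) ((f : MulAut Q) a) : Q) : S) = _
    rw [hse, htf]
    group
  inv_mem' := by
    rintro e ⟨s, hs, hse⟩
    refine ⟨s⁻¹, inv_mem hs, fun a => ?_⟩
    have h := hse (((e : MulAut Q)⁻¹) a)
    rw [MulAut.apply_inv_self] at h
    rw [h, Subgroup.coe_inv]
    group

end Basic

section Saturation

/-- A pro-`p` group: a profinite group all of whose quotients by open normal subgroups are
`p`-groups. -/
structure IsProPGroup (p : ℕ) (G : Type u) [Group G] [TopologicalSpace G] : Prop where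
  isTopologicalGroup : IsTopologicalGroup G
  compactSpace : CompactSpace G
  totallyDisconnectedSpace : TotallyDisconnectedSpace G
  isPGroup_quotient : ∀ (U : Subgroup G) [U.Normal], IsOpen (U : Set G) → IsPGroup p (G ⧸ U)

/-- `H` is a Sylow pro-`p` subgroup of the profinite group `G`: it is a closed pro-`p` subgroup
whose index is prime to `p`, the index being the least common multiple of the indices
`|G : HU|` over all open normal subgroups `U` of `G`. -/
structure IsSylowProP (p : ℕ) {G : Type u} [Group G] [TopologicalSpace G] (H : Subgroup G) :
    Prop where
  isClosed : IsClosed (H : Set G)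
  isProPGroup : IsProPGroup p H
  not_dvd_index : ∀ U : Subgroup G, U.Normal → IsOpen (U : Set G) → ¬ p ∣ (H ⊔ U).index

variable {S : Type u} [Group S] [TopologicalSpace S]

/-- For `φ : R → Q`, the closed subgroup `N_φ` of those `a ∈ N_S(R)` for which there is
`b ∈ N_S(Q)` such that `φ(a r a⁻¹) = b φ(r) b⁻¹` for all `r ∈ R` (below, `r'` is the element
`a r a⁻¹` of `R`). -/
def extender [IsTopologicalGroup S] [CompactSpace S] [T2Space S] {R Q : ClosedSubgroup S}
    (φ : R →ₜ* Q) : ClosedSubgroup S where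
  carrier := {a | a ∈ R.normalizer ∧ ∃ b ∈ Q.normalizer, ∀ r r' : R,
    (r' : S) = a * r * a⁻¹ → (φ r' : S) = b * φ r * b⁻¹}
  one_mem' := by
    refine ⟨one_mem _, 1, one_mem _, fun r r' h => ?_⟩
    have : r' = r := Subtype.ext (by simpa using h)
    simp [this]
  mul_mem' := by
    rintro a a' ⟨ha, b, hb, h⟩ ⟨ha', b', hb', h'⟩
    refine ⟨mul_mem ha ha', b * b', mul_mem hb hb', fun r r' hr => ?_⟩
    have hm : a' * r * a'⁻¹ ∈ R := (ha' r).1 r.2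
    rw [h ⟨_, hm⟩ r' (by rw [hr]; group), h' r ⟨_, hm⟩ rfl]
    group
  inv_mem' := by
    rintro a ⟨ha, b, hb, h⟩
    refine ⟨inv_mem ha, b⁻¹, inv_mem hb, fun r r' hr => ?_⟩
    rw [h r' r (by rw [hr]; group)]
    group
  isClosed' := by
    let C : Set (S × S) := {z | z.1 ∈ (R.normalizer : Set S)} ∩ {z | z.2 ∈ (Q.normalizer : Set S)} ∩
      {z | ∀ r r' : R, (r' : S) = z.1 * r * z.1⁻¹ → (φ r' : S) = z.2 * φ r * z.2⁻¹}
    have hR : IsClosed (R.normalizer : Set S) := R.normalizer.isClosed'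
    have hQ : IsClosed (Q.normalizer : Set S) := Q.normalizer.isClosed'
    have hRc : IsClosed (R : Set S) := R.isClosed'
    have hC : IsClosed C := by
      let N := {z : S × S | z.1 ∈ (R.normalizer : Set S)} ∩ {z | z.2 ∈ (Q.normalizer : Set S)}
      have hN : IsClosed N := (hR.preimage continuous_fst).inter (hQ.preimage continuous_snd)
      have key : IsClosed {z : N | ∀ r : R,
          (φ ⟨z.1.1 * r * z.1.1⁻¹, (z.2.1 r).1 r.2⟩ : S) = z.1.2 * φ r * z.1.2⁻¹} := by
        simp only [Set.ofPred_forall]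
        refine isClosed_iInter fun r => isClosed_eq ?_ ?_
        · exact continuous_subtype_val.comp (φ.continuous_toFun.comp
            (Continuous.subtype_mk (by fun_prop) _))
        · fun_prop
      have := hN.isClosedEmbedding_subtypeVal.isClosedMap _ key
      convert this using 1
      ext z
      constructor
      · rintro ⟨hz, h⟩
        exact ⟨⟨z, hz⟩, fun r => h r ⟨_, (hz.1 r).1 r.2⟩ rfl, rfl⟩
      · rintro ⟨⟨z, hz⟩, h, rfl⟩
        refine ⟨hz, fun r r' hr => ?_⟩
        have : r' = ⟨_, (hz.1 r).1 r.2⟩ := Subtype.ext hr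
        rw [this]
        exact h r
    have himg : IsClosed (Prod.fst '' C) := (hC.isCompact.image continuous_fst).isClosed
    convert himg using 1
    ext a
    constructor
    · rintro ⟨ha, b, hb, h⟩
      exact ⟨(a, b), ⟨⟨ha, hb⟩, h⟩, rfl⟩
    · rintro ⟨⟨a, b⟩, ⟨⟨ha, hb⟩, h⟩, rfl⟩
      exact ⟨ha, b, hb, h⟩

theorem le_extender [IsTopologicalGroup S] [CompactSpace S] [T2Space S] {R Q : ClosedSubgroup S}
    (φ : R →ₜ* Q) (r : R) : (r : S) ∈ extender φ := by
  refine ⟨Subgroup.le_normalizer (H := R.toSubgroup) r.2, φ r,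
    Subgroup.le_normalizer (H := Q.toSubgroup) (φ r).2, fun t t' h => ?_⟩
  have : t' = r * t * r⁻¹ := Subtype.ext h
  simp [this]

/-- `Q` is receptive in `F`: every isomorphism `φ : R → Q` of `F` extends to a morphism
`N_φ → N_S(Q)` of `F`. -/
def IsReceptive [IsTopologicalGroup S] [CompactSpace S] [T2Space S] (F : SubgroupCategory S)
    (Q : ClosedSubgroup S) : Prop :=
  ∀ (R : ClosedSubgroup S) (φ : R →ₜ* Q), F.IsIso φ →
    ∃ ψ ∈ F.Hom (extender φ) Q.normalizer, ∀ r : R, (ψ ⟨r, le_extender φ r⟩ : S) = φ r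

/-- `Q` is fully automized in `F`: `Aut_S(Q)` is a Sylow pro-`p` subgroup of `Aut_F(Q)`. -/
def IsFullyAutomized (p : ℕ) (F : SubgroupCategory S) (Q : ClosedSubgroup S) : Prop :=
  IsSylowProP p (F.autInner Q)

/-- `Q` is fully normalized in `F`: it is receptive and fully automized. -/
def IsFullyNormalized [IsTopologicalGroup S] [CompactSpace S] [T2Space S] (p : ℕ)
    (F : SubgroupCategory S) (Q : ClosedSubgroup S) : Prop :=
  F.IsReceptive Q ∧ F.IsFullyAutomized p Q

/-- `F` is saturated: every isomorphism class of `F` contains a fully normalized subgroup. -/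
def IsSaturated [IsTopologicalGroup S] [CompactSpace S] [T2Space S] (p : ℕ)
    (F : SubgroupCategory S) : Prop :=
  ∀ P : ClosedSubgroup S, ∃ Q : ClosedSubgroup S,
    (∃ φ : P →ₜ* Q, F.IsIso φ) ∧ F.IsFullyNormalized p Q

end Saturation

section Morphisms

variable {S : Type u} [Group S] [TopologicalSpace S] [CompactSpace S]
  {T : Type v} [Group T] [TopologicalSpace T] [CompactSpace T]

/-- `α : S → T` is a morphism from `F` to `G`: each morphism `φ : P → Q` of `F` induces a
morphism `ψ : α(P) → α(Q)` of `G`, in the sense that `ψ α = α φ` on `P`. Such a `ψ` is unique,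
hence depends functorially on `φ`. -/
def IsMorphism [T2Space T] (F : SubgroupCategory S) (G : SubgroupCategory T) (α : S →ₜ* T) :
    Prop :=
  ∀ (P Q : ClosedSubgroup S), ∀ φ ∈ F.Hom P Q, ∃ ψ ∈ G.Hom (P.image α) (Q.image α),
    ∀ a : P, (ψ ⟨α a, P.apply_mem_image α a⟩ : T) = α (φ a)

/-- `F` and `G` are isomorphic: there is an isomorphism of topological groups `S ≃ T` which is,
with its inverse, a morphism between `F` and `G`. -/
def IsIsomorphic [T2Space S] [T2Space T] (F : SubgroupCategory S) (G : SubgroupCategory T) :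
    Prop :=
  ∃ e : S ≃ₜ* T, IsMorphism F G (e : S →ₜ* T) ∧ IsMorphism G F (e.symm : T →ₜ* S)

end Morphisms

end SubgroupCategory

/-- An inverse system, indexed by `I`, of fusion systems `fus i` on finite (discrete) `p`-groups
`grp i`, with transition morphisms `map : fus j → fus i` for `i ≤ j`. -/
structure FusionInverseSystem (p : ℕ) (I : Type w) [PartialOrder I] where
  grp : I → Type v
  [group : ∀ i, Group (grp i)]
  [topologicalSpace : ∀ i, TopologicalSpace (grp i)]
  [discreteTopology : ∀ i, DiscreteTopology (grp i)]
  [finite : ∀ i, Finite (grp i)]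
  isPGroup : ∀ i, IsPGroup p (grp i)
  fus : ∀ i, SubgroupCategory (grp i)
  isFusionSystem : ∀ i, (fus i).IsFusionSystem
  map : ∀ {i j : I}, i ≤ j → (grp j →ₜ* grp i)
  map_id : ∀ (i : I) (a : grp i), map (le_refl i) a = a
  map_comp : ∀ {i j k : I} (hij : i ≤ j) (hjk : j ≤ k) (a : grp k),
    map hij (map hjk a) = map (hij.trans hjk) a
  isMorphism : ∀ {i j : I} (hij : i ≤ j),
    SubgroupCategory.IsMorphism (fus j) (fus i) (map hij)

attribute [instance] FusionInverseSystem.group FusionInverseSystem.topologicalSpace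
  FusionInverseSystem.discreteTopology FusionInverseSystem.finite

namespace FusionInverseSystem

variable {p : ℕ} {I : Type w} [PartialOrder I] (D : FusionInverseSystem.{v, w} p I)

/-- The inverse limit of the groups `D.grp i`, as a subgroup of their product. -/
def limSubgroup : Subgroup (∀ i, D.grp i) where
  carrier := {a | ∀ (i j : I) (hij : i ≤ j), D.map hij (a j) = a i}
  one_mem' := fun i j hij => by simp
  mul_mem' := fun {a b} ha hb i j hij => by simp [ha i j hij, hb i j hij]
  inv_mem' := fun {a} ha i j hij => by simp [ha i j hij]

/-- The inverse limit group, with the topology induced by the product topology. -/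
abbrev Lim : Type (max v w) := D.limSubgroup

theorem isClosed_limSubgroup : IsClosed (D.limSubgroup : Set (∀ i, D.grp i)) := by
  have h : (D.limSubgroup : Set (∀ i, D.grp i)) =
      ⋂ (i : I) (j : I) (hij : i ≤ j), {a | D.map hij (a j) = a i} := by
    ext a
    simp only [Set.mem_iInter, Set.mem_ofPred_eq]
    rfl
  rw [h]
  refine isClosed_iInter fun i => isClosed_iInter fun j => isClosed_iInter fun hij => ?_
  exact isClosed_eq ((D.map hij).continuous_toFun.comp (continuous_apply j)) (continuous_apply i)

instance instCompactSpaceLim : CompactSpace D.Lim :=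
  isCompact_iff_compactSpace.mp D.isClosed_limSubgroup.isCompact

/-- The projection from the limit group to `D.grp i`. -/
def proj (i : I) : D.Lim →ₜ* D.grp i where
  toMonoidHom := (Pi.evalMonoidHom D.grp i).comp D.limSubgroup.subtype
  continuous_toFun := (continuous_apply i).comp continuous_subtype_val

/-- The inverse limit of the system, on the group `D.Lim`. A compatible family of morphisms
`f i` in `Hom (proj i P) (proj i Q)` is the same thing as a homomorphism `φ : P → Q` inducing a
morphism of `D.fus i` for each `i` (the `f i` are then unique, and compatible, since
`P → proj i P` is onto; see also `existsUnique_of_compatible` for the converse). -/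
def lim : SubgroupCategory D.Lim where
  Hom P Q := {φ | ∀ i, ∃ f ∈ (D.fus i).Hom (P.image (D.proj i)) (Q.image (D.proj i)),
    ∀ a : P, (f ⟨D.proj i a, P.apply_mem_image _ a⟩ : D.grp i) = D.proj i (φ a)}
  id_mem P i := ⟨_, (D.fus i).id_mem _, fun _ => rfl⟩
  comp_mem := by
    intro P Q R φ ψ hφ hψ i
    obtain ⟨f, hf, hfφ⟩ := hφ i
    obtain ⟨g, hg, hgψ⟩ := hψ i
    refine ⟨g.comp f, (D.fus i).comp_mem hf hg, fun a => ?_⟩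
    have h : f ⟨D.proj i a, P.apply_mem_image _ a⟩ =
        ⟨D.proj i (φ a), Q.apply_mem_image _ (φ a)⟩ := Subtype.ext (hfφ a)
    change (g (f _) : D.grp i) = D.proj i (ψ (φ a))
    rw [h, hgψ]

/-- Each element of the inverse limit of the sets `Hom (proj i P) (proj i Q)` comes from exactly
one morphism of `D.lim`. -/
theorem existsUnique_of_compatible [Nonempty I] [IsDirectedOrder I] (P Q : ClosedSubgroup D.Lim)
    (f : ∀ i, P.image (D.proj i) →ₜ* Q.image (D.proj i))
    (hf : ∀ i, f i ∈ (D.fus i).Hom (P.image (D.proj i)) (Q.image (D.proj i)))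
    (hc : ∀ (i j : I) (hij : i ≤ j) (a : P.image (D.proj i)) (b : P.image (D.proj j)),
      (a : D.grp i) = D.map hij b → (f i a : D.grp i) = D.map hij (f j b)) :
    ∃! φ : P →ₜ* Q, φ ∈ D.lim.Hom P Q ∧
      ∀ i, ∀ a : P, (f i ⟨D.proj i a, P.apply_mem_image _ a⟩ : D.grp i) = D.proj i (φ a) := by
  let y : P → ∀ i, D.grp i := fun a i => f i ⟨D.proj i a, P.apply_mem_image _ a⟩
  have hy : ∀ a, y a ∈ D.limSubgroup := fun a i j hij =>
    (hc i j hij _ _ (a.1.2 i j hij).symm).symm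
  have hyQ : ∀ a, (⟨y a, hy a⟩ : D.Lim) ∈ Q := by
    intro a
    have hQ : IsClosed (Q : Set D.Lim) := Q.isClosed'
    change _ ∈ (Q : Set D.Lim)
    rw [← hQ.closure_eq, mem_closure_iff_nhds]
    intro t ht
    rw [mem_nhds_subtype] at ht
    obtain ⟨u, hu, hut⟩ := ht
    rw [nhds_pi, Filter.mem_pi] at hu
    obtain ⟨K, hK, V, hV, hVu⟩ := hu
    obtain ⟨k, hk⟩ := hK.toFinset.exists_le
    obtain ⟨q, hq, hqk⟩ := (f k ⟨D.proj k a, P.apply_mem_image _ a⟩).2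
    refine ⟨q, hut (hVu fun i hi => ?_), hq⟩
    have hik := hk i (hK.mem_toFinset.2 hi)
    have : q.1 i = y a i := by
      rw [← q.2 i k hik, ← hy a i k hik]
      exact congrArg _ hqk
    rw [this]
    exact mem_of_mem_nhds (hV i)
  let φ : P →ₜ* Q :=
    { toFun := fun a => ⟨⟨y a, hy a⟩, hyQ a⟩
      map_one' := by
        apply Subtype.ext; apply Subtype.ext; funext i
        exact congrArg Subtype.val (map_one (f i))
      map_mul' := fun a b => by
        apply Subtype.ext; apply Subtype.ext; funext i
        exact congrArg Subtype.val (map_mul (f i) ⟨D.proj i a, P.apply_mem_image _ a⟩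
          ⟨D.proj i b, P.apply_mem_image _ b⟩)
      continuous_toFun := by
        refine Continuous.subtype_mk (Continuous.subtype_mk (continuous_pi fun i => ?_) _) _
        exact continuous_subtype_val.comp ((f i).continuous_toFun.comp
          (Continuous.subtype_mk ((D.proj i).continuous_toFun.comp continuous_subtype_val) _)) }
  refine ⟨φ, ⟨fun i => ⟨f i, hf i, fun _ => rfl⟩, fun _ _ => rfl⟩, ?_⟩
  rintro ψ ⟨-, hψ⟩
  ext a i
  exact (hψ i a).symm

end FusionInverseSystem

namespace SubgroupCategory

variable {S : Type u} [Group S] [TopologicalSpace S] [CompactSpace S] [T2Space S]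

/-- `F` is countably based: it is isomorphic to the inverse limit of a system of fusion systems
on finite `p`-groups indexed by the natural numbers. -/
def IsCountablyBased (p : ℕ) (F : SubgroupCategory S) : Prop :=
  ∃ D : FusionInverseSystem.{v, 0} p ℕ, IsIsomorphic F D.lim

/-- `F` is pro-saturated: it is isomorphic to the inverse limit of a system of saturated fusion
systems on finite `p`-groups indexed by a directed set. -/
def IsProSaturated (p : ℕ) (F : SubgroupCategory S) : Prop :=
  ∃ (I : Type w) (_ : PartialOrder I) (_ : Nonempty I) (_ : IsDirectedOrder I)
    (D : FusionInverseSystem.{v, w} p I), (∀ i, (D.fus i).IsSaturated p) ∧ IsIsomorphic F D.lim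

end SubgroupCategory

/-! Each class of subgroups must contain one that is receptive and fully automized. The two
presentations of `F` play different roles: the one indexed by `ℕ` selects the subgroup, the one by
saturated systems shows that it works.

Selection (`exists_isConj_normalizer_le`). Among the conjugates of `P`, take `Q` for which the
sequence of orders of the images of `N_S(Q)` at levels 0, 1, 2, ... is lexicographically largest.
Such a `Q` exists by compactness: conjugates that are maximal up to level `n` accumulate at a
conjugate whose normalizer contains a limit of their normalizers. If a morphism of `F` is defined on
`N_S(Q)` and maps `Q` onto `R`, it embeds `N_S(Q)` in `N_S(R)` without changing the orders at any
level, so maximality forces the image to be all of `N_S(R)`.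

Comparison (`exists_isNormalizerLimit`). At each level `j` of the saturated system, the image `A_j`
of `Q` has a fully normalized conjugate `B_j` and a morphism `χ j` on `N(A_j)` taking `A_j` to `B_j`
(`IsSaturated.exists_normalizer_map`). The `B_j` and `χ j` need not be compatible, but along an
ultrafilter the `χ j` converge to a morphism `χ'` of `F` taking `Q` to some `R`. By the choice of
`Q`, it maps `N_S(Q)` onto `N_S(R)`.

Receptivity (`isReceptive_of_isNormalizerLimit`). An isomorphism onto `Q`, followed at level `j` by
`χ j`, extends by receptivity of `B_j`. A limit of these extensions takes values in `N_S(R)`, where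
the inverse of `χ'` is defined; composing with it gives the extension required.

Full automization (`isFullyAutomized_of_isNormalizerLimit`). At a fixed level, the automorphisms
induced by `Aut_F(Q)` are among those coming from `Aut(B_j)` for a suitable `j`, and those coming
from the inner part of `Aut(B_j)` are induced by `Aut_S(Q)`, again since `χ'` covers `N_S(R)`. Hence
the index in question divides one that is prime to `p`.

Morphisms are handled throughout as their graphs, closed subgroups of `S × S`, so that limits of
morphisms are limits of subgroups and domains and codomains need not match in advance. -/

/-! ### Limits of subgroups along ultrafilters -/

theorem Ultrafilter.exists_eventually_eq {A X : Type*} [Finite X] (U : Ultrafilter A) (f : A → X) :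
    ∃ x, ∀ᶠ a in U, f a = x := by
  obtain ⟨x, hx⟩ := Ultrafilter.eq_pure_of_finite (U.map f)
  refine ⟨x, ?_⟩
  have h : {x} ∈ U.map f := by
    rw [hx]
    exact Ultrafilter.mem_pure.2 rfl
  exact h

theorem Subgroup.le_normalizer_of_conj_mem {G : Type*} [Group G] {N Q : Subgroup G}
    (h : ∀ x ∈ N, ∀ q ∈ Q, x * q * x⁻¹ ∈ Q) : N ≤ Subgroup.normalizer (Q : Set G) := by
  intro x hx
  refine Subgroup.mem_normalizer_iff.2 fun q => ⟨h x hx q, fun hq => ?_⟩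
  simpa [mul_assoc] using h _ (inv_mem hx) _ hq

/-- The compact group `G` is, by means of the maps `g i`, the inverse limit of the groups `H i`
with the transition maps `t i j`. -/
structure IsGroupLimit {I : Type*} [Preorder I] {G : Type*} [Group G] [TopologicalSpace G]
    {H : I → Type*} [∀ i, Group (H i)] (t : ∀ {i j : I}, i ≤ j → H j →* H i)
    (g : ∀ i, G →* H i) : Prop where
  -- This is continuity for the discrete topology on `H i`, without a topology on `H i` being part
  -- of the data.
  isClosed_preimage : ∀ i (A : Set (H i)), IsClosed (g i ⁻¹' A)
  map_apply : ∀ {i j : I} (hij : i ≤ j) (a : G), t hij (g j a) = g i a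
  map_map : ∀ {i j k : I} (hij : i ≤ j) (hjk : j ≤ k) (a : H k),
    t hij (t hjk a) = t (hij.trans hjk) a
  eq_one : ∀ a : G, (∀ i, g i a = 1) → a = 1
  exists_of_compatible : ∀ a : ∀ i, H i, (∀ (i j : I) (hij : i ≤ j), t hij (a j) = a i) →
    ∃ b, ∀ i, g i b = a i

namespace IsGroupLimit

variable {I : Type*} [Preorder I] {G : Type*} [Group G] [TopologicalSpace G]
  {H : I → Type*} [∀ i, Group (H i)] {t : ∀ {i j : I}, i ≤ j → H j →* H i} {g : ∀ i, G →* H i}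

/-- Needed because graphs of morphisms are subgroups of `G × G`. -/
theorem prod (h : IsGroupLimit (G := G) (H := H) t g) :
    IsGroupLimit (G := G × G) (H := fun i => H i × H i)
      (fun hij => (t hij).prodMap (t hij)) (fun i => (g i).prodMap (g i)) where
  isClosed_preimage i A := by
    have : ((g i).prodMap (g i)) ⁻¹' A = ⋂ z ∈ Aᶜ,
        ((Prod.fst ⁻¹' (g i ⁻¹' {z.1}ᶜ)) ∪ (Prod.snd ⁻¹' (g i ⁻¹' {z.2}ᶜ))) := by
      ext ⟨a, b⟩
      simp only [Set.mem_preimage, Set.mem_iInter, Set.mem_union, Set.mem_compl_iff,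
        Set.mem_singleton_iff, MonoidHom.prodMap_def, MonoidHom.prod_apply]
      constructor
      · intro hA z hz
        by_contra! h'
        have hz' : ((g i a, g i b) : H i × H i) = z := Prod.ext h'.1 h'.2
        exact hz (hz' ▸ hA)
      · intro hA
        by_contra h'
        rcases hA _ h' with h1 | h1 <;> exact h1 rfl
    rw [this]
    exact isClosed_biInter fun z _ => ((h.isClosed_preimage i _).preimage continuous_fst).union
      ((h.isClosed_preimage i _).preimage continuous_snd)
  map_apply hij a := Prod.ext (h.map_apply hij _) (h.map_apply hij _)
  map_map hij hjk a := Prod.ext (h.map_map hij hjk _) (h.map_map hij hjk _)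
  eq_one a ha := Prod.ext (h.eq_one _ fun i => congrArg Prod.fst (ha i))
    (h.eq_one _ fun i => congrArg Prod.snd (ha i))
  exists_of_compatible a ha := by
    obtain ⟨b, hb⟩ := h.exists_of_compatible (fun i => (a i).1)
      fun i j hij => congrArg Prod.fst (ha i j hij)
    obtain ⟨c, hc⟩ := h.exists_of_compatible (fun i => (a i).2)
      fun i j hij => congrArg Prod.snd (ha i j hij)
    exact ⟨(b, c), fun i => Prod.ext (hb i) (hc i)⟩

variable (h : IsGroupLimit (G := G) (H := H) t g)
include h

/-- The elements of `Γ` that agree with `a` at level `i` form nonempty closed sets, directed in `i`.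
By compactness some element of `Γ` agrees with `a` at all levels, hence equals `a`. -/
theorem mem_of_forall [CompactSpace G] [Nonempty I] [IsDirectedOrder I] {Γ : Subgroup G}
    (hΓ : IsClosed (Γ : Set G)) {a : G} (ha : ∀ i, g i a ∈ Γ.map (g i)) : a ∈ Γ := by
  have : (⋂ i, ((Γ : Set G) ∩ g i ⁻¹' {g i a})).Nonempty := by
    have hc : ∀ i, IsClosed ((Γ : Set G) ∩ g i ⁻¹' {g i a}) :=
      fun i => hΓ.inter (h.isClosed_preimage i _)
    apply IsCompact.nonempty_iInter_of_directed_nonempty_isCompact_isClosed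
    · intro i j
      obtain ⟨k, hik, hjk⟩ := exists_ge_ge i j
      have key : ∀ l, l ≤ k → ((Γ : Set G) ∩ g k ⁻¹' {g k a}) ⊆ (Γ : Set G) ∩ g l ⁻¹' {g l a} := by
        rintro l hl b ⟨hb, hb'⟩
        refine ⟨hb, ?_⟩
        rw [Set.mem_preimage, Set.mem_singleton_iff] at hb' ⊢
        rw [← h.map_apply hl, hb', h.map_apply hl]
      exact ⟨k, key i hik, key j hjk⟩
    · intro i
      obtain ⟨b, hb, hba⟩ := ha i
      exact ⟨b, hb, hba⟩
    · exact fun i => (hc i).isCompact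
    · exact hc
  obtain ⟨b, hb⟩ := this
  rw [Set.mem_iInter] at hb
  have hab : a * b⁻¹ = 1 := h.eq_one _ fun i => by
    rw [map_mul, map_inv, show g i b = g i a from (hb i).2, mul_inv_cancel]
  rw [mul_inv_eq_one.1 hab]
  exact (hb (Classical.arbitrary I)).1

theorem le_of_forall [CompactSpace G] [Nonempty I] [IsDirectedOrder I] {Γ Δ : Subgroup G}
    (hΔ : IsClosed (Δ : Set G)) (hle : ∀ i, Γ.map (g i) ≤ Δ.map (g i)) : Γ ≤ Δ :=
  fun _ ha => h.mem_of_forall hΔ fun i => hle i ⟨_, ha, rfl⟩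

/-- A family of subgroups of the groups `H i` which is compatible in the limit along an
ultrafilter converges to a closed subgroup of the inverse limit. -/
theorem exists_ultralimit [∀ i, Finite (H i)] [Nonempty I] [IsDirectedOrder I] {J : Type*}
    (U : Ultrafilter J) (Λ : ∀ i, J → Subgroup (H i))
    (hΛ : ∀ {i j : I} (hij : i ≤ j), ∀ᶠ a in U, (Λ j a).map (t hij) = Λ i a) :
    ∃ Γ : Subgroup G, IsClosed (Γ : Set G) ∧ ∀ i, ∀ᶠ a in U, Γ.map (g i) = Λ i a := by
  choose L hL using fun i => U.exists_eventually_eq (Λ i)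
  have hLt : ∀ {i j : I} (hij : i ≤ j), (L j).map (t hij) = L i := by
    intro i j hij
    obtain ⟨a, h1, h2, h3⟩ := ((hΛ hij).and ((hL i).and (hL j))).exists
    rw [← h3, h1, h2]
  refine ⟨⨅ i, (L i).comap (g i), ?_, fun i => ?_⟩
  · simp only [Subgroup.coe_iInf, Subgroup.coe_comap]
    exact isClosed_iInter fun i => h.isClosed_preimage i _
  · suffices hmap : (⨅ i, (L i).comap (g i)).map (g i) = L i by
      filter_upwards [hL i] with a ha
      rw [hmap, ha]
    apply le_antisymm
    · rintro _ ⟨a, ha, rfl⟩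
      exact (Subgroup.mem_iInf.1 ha i)
    · intro a ha
      -- The element `a` has a preimage `b j` at each level `j` above `i`, but these need not be
      -- compatible. A second ultrafilter, on the levels, repairs this: the component `c k` of the
      -- thread is the image at level `k` of `b j` for almost all `j`.
      let V : Ultrafilter I := Ultrafilter.of Filter.atTop
      have hV : ∀ k, ∀ᶠ j in (V : Filter I), k ≤ j := fun k =>
        Ultrafilter.of_le Filter.atTop (Filter.eventually_ge_atTop k)
      have hb : ∀ j, ∃ b ∈ L j, ∀ hij : i ≤ j, t hij b = a := by
        intro j
        by_cases hij : i ≤ j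
        · rw [← hLt hij] at ha
          obtain ⟨b, hb, hba⟩ := ha
          exact ⟨b, hb, fun _ => hba⟩
        · exact ⟨1, one_mem _, fun h' => absurd h' hij⟩
      choose b hb hba using hb
      classical
      choose c hc using fun k => V.exists_eventually_eq
        (fun j => if hkj : k ≤ j then t hkj (b j) else 1)
      have hc' : ∀ k, ∀ᶠ j in V, ∃ hkj : k ≤ j, t hkj (b j) = c k := fun k => by
        filter_upwards [hc k, hV k] with j h1 h2
        rw [dif_pos h2] at h1
        exact ⟨h2, h1⟩
      obtain ⟨s, hs⟩ := h.exists_of_compatible c fun k l hkl => by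
        obtain ⟨j, ⟨h1, h2⟩, h3, h4⟩ := ((hc' k).and (hc' l)).exists
        rw [← h4, h.map_map, h2]
      refine ⟨s, Subgroup.mem_iInf.2 fun k => ?_, ?_⟩
      · obtain ⟨j, h1, h2⟩ := (hc' k).exists
        rw [Subgroup.mem_comap, hs, ← h2, ← hLt h1]
        exact ⟨_, hb j, rfl⟩
      · obtain ⟨j, h1, h2⟩ := (hc' i).exists
        rw [hs, ← h2, hba]

/-- A family of subgroups of the inverse limit accumulates at a closed subgroup. -/
theorem exists_ultralimit_of_family [∀ i, Finite (H i)] [Nonempty I] [IsDirectedOrder I]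
    {J : Type*} (U : Ultrafilter J) (Λ : J → Subgroup G) :
    ∃ Γ : Subgroup G, IsClosed (Γ : Set G) ∧
      ∀ i, ∀ᶠ a in U, Γ.map (g i) = (Λ a).map (g i) :=
  h.exists_ultralimit U (fun i a => (Λ a).map (g i)) fun {i j} hij => by
    refine Filter.Eventually.of_forall fun a => ?_
    rw [Subgroup.map_map]
    congr 1
    ext b
    exact h.map_apply hij b

theorem le_normalizer_of_forall [CompactSpace G] [Nonempty I] [IsDirectedOrder I]
    {N Q : Subgroup G} (hQ : IsClosed (Q : Set G))
    (hN : ∀ i, N.map (g i) ≤ Subgroup.normalizer (Q.map (g i) : Set (H i))) :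
    N ≤ Subgroup.normalizer (Q : Set G) :=
  Subgroup.le_normalizer_of_conj_mem fun x hx q hq => h.mem_of_forall hQ fun i => by
    rw [map_mul, map_mul, map_inv]
    exact (Subgroup.mem_normalizer_iff.1 (hN i ⟨x, hx, rfl⟩) _).1 ⟨q, hq, rfl⟩

/-- A family of subgroups of the groups `H j` accumulates at a closed subgroup of the inverse
limit. -/
theorem exists_ultralimit_of_levels [∀ i, Finite (H i)] [Nonempty I] [IsDirectedOrder I]
    (U : Ultrafilter I) (hU : ∀ k, ∀ᶠ j in (U : Filter I), k ≤ j) (Λ : ∀ j, Subgroup (H j)) :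
    ∃ Γ : Subgroup G, IsClosed (Γ : Set G) ∧
      ∀ i, ∀ᶠ j in U, ∃ hij : i ≤ j, Γ.map (g i) = (Λ j).map (t hij) := by
  classical
  obtain ⟨Γ, hΓ, hΓΛ⟩ := h.exists_ultralimit U
    (fun i j => if hij : i ≤ j then (Λ j).map (t hij) else ⊥) (fun {i j} hij => by
      filter_upwards [hU j] with k hk
      rw [dif_pos hk, dif_pos (hij.trans hk), Subgroup.map_map]
      congr 1
      ext a
      exact h.map_map hij hk a)
  refine ⟨Γ, hΓ, fun i => ?_⟩
  filter_upwards [hΓΛ i, hU i] with j h1 h2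
  rw [dif_pos h2] at h1
  exact ⟨h2, h1⟩

end IsGroupLimit

/-! ### Homomorphisms as closed subgroups of a product -/

section Graph

variable {S : Type u} [Group S] [TopologicalSpace S]

/-- The graph of a homomorphism between closed subgroups of `S`. -/
def ClosedSubgroup.graph {P Q : ClosedSubgroup S} (φ : P →ₜ* Q) : Subgroup (S × S) where
  carrier := {z | ∃ a : P, (a : S) = z.1 ∧ (φ a : S) = z.2}
  one_mem' := ⟨1, rfl, by rw [map_one]; rfl⟩
  mul_mem' := by
    rintro _ _ ⟨a, ha, ha'⟩ ⟨b, hb, hb'⟩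
    refine ⟨a * b, ?_, ?_⟩
    · rw [Prod.fst_mul, ← ha, ← hb]; rfl
    · rw [map_mul, Prod.snd_mul, ← ha', ← hb']; rfl
  inv_mem' := by
    rintro _ ⟨a, ha, ha'⟩
    refine ⟨a⁻¹, ?_, ?_⟩
    · rw [Prod.fst_inv, ← ha]; rfl
    · rw [map_inv, Prod.snd_inv, ← ha']; rfl

namespace ClosedSubgroup

theorem mem_graph {P Q : ClosedSubgroup S} {φ : P →ₜ* Q} {z : S × S} :
    z ∈ graph φ ↔ ∃ a : P, (a : S) = z.1 ∧ (φ a : S) = z.2 :=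
  Iff.rfl

theorem apply_mem_graph {P Q : ClosedSubgroup S} (φ : P →ₜ* Q) (a : P) :
    ((a : S), (φ a : S)) ∈ graph φ :=
  ⟨a, rfl, rfl⟩

theorem apply_eq_of_mem_graph {P Q : ClosedSubgroup S} {φ : P →ₜ* Q} {a : P} {y : S}
    (h : ((a : S), y) ∈ graph φ) : (φ a : S) = y := by
  obtain ⟨b, hb, hb'⟩ := h
  rw [← show b = a from Subtype.ext hb]
  exact hb'

theorem isClosed_graph [CompactSpace S] [T2Space S] {P Q : ClosedSubgroup S} (φ : P →ₜ* Q) :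
    IsClosed (graph φ : Set (S × S)) := by
  have : (graph φ : Set (S × S)) = Set.range fun a : P => ((a : S), (φ a : S)) := by
    ext z
    exact exists_congr fun a => (Prod.ext_iff (x := ((a : S), (φ a : S)))).symm
  rw [this]
  have hP : CompactSpace P := isCompact_iff_compactSpace.mp P.isClosed'.isCompact
  refine (isCompact_range ?_).isClosed
  exact continuous_subtype_val.prodMk (continuous_subtype_val.comp φ.continuous_toFun)

/-- The inclusion of a closed subgroup into another one. -/
def inclusion {P Q : ClosedSubgroup S} (h : P ≤ Q) : P →ₜ* Q where
  toFun a := ⟨a, h a.2⟩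
  map_one' := rfl
  map_mul' _ _ := rfl
  continuous_toFun := by fun_prop

/-- A closed functional relation is the graph of a continuous homomorphism. -/
theorem exists_graph_eq [CompactSpace S] [T2Space S] {Γ : Subgroup (S × S)}
    (hΓ : IsClosed (Γ : Set (S × S))) (hf : ∀ y, (1, y) ∈ Γ → y = 1) (P Q : ClosedSubgroup S)
    (hP : ∀ x, x ∈ P ↔ ∃ y, (x, y) ∈ Γ) (hQ : ∀ x y, (x, y) ∈ Γ → y ∈ Q) :
    ∃ φ : P →ₜ* Q, graph φ = Γ := by
  have hf' : ∀ {x y y'}, (x, y) ∈ Γ → (x, y') ∈ Γ → y = y' := by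
    intro x y y' h h'
    have := hf (y * y'⁻¹) (by simpa using mul_mem h (inv_mem h'))
    rwa [mul_inv_eq_one] at this
  choose f hfΓ using fun a : P => (hP a).1 a.2
  let φ : P →ₜ* Q :=
    { toFun := fun a => ⟨f a, hQ _ _ (hfΓ a)⟩
      map_one' := Subtype.ext (hf' (hfΓ 1) (one_mem Γ))
      map_mul' := fun a b => Subtype.ext (hf' (hfΓ (a * b)) (mul_mem (hfΓ a) (hfΓ b)))
      continuous_toFun := by
        refine Continuous.subtype_mk ?_ _
        refine continuous_iff_isClosed.2 fun C hC => ?_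
        -- Closed graph argument: the preimage of `C` is the projection of a compact set.
        have himg : IsClosed (Prod.fst '' ((Γ : Set (S × S)) ∩ Prod.snd ⁻¹' C)) :=
          ((hΓ.inter (hC.preimage continuous_snd)).isCompact.image continuous_fst).isClosed
        convert himg.preimage (continuous_subtype_val (p := (· ∈ P))) using 1
        ext a
        constructor
        · exact fun ha => ⟨(a, f a), ⟨hfΓ a, ha⟩, rfl⟩
        · rintro ⟨⟨x, y⟩, ⟨hxy, hy⟩, rfl⟩
          rw [Set.mem_preimage, hf' (hfΓ a) hxy]
          exact hy }
  refine ⟨φ, ?_⟩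
  ext ⟨x, y⟩
  constructor
  · rintro ⟨a, rfl, rfl⟩
    exact hfΓ a
  · intro h
    exact ⟨⟨x, (hP x).2 ⟨y, h⟩⟩, rfl, hf' (hfΓ _) h⟩

/-- The domain of a closed relation. -/
def domain [CompactSpace S] [T2Space S] (Γ : Subgroup (S × S))
    (hΓ : IsClosed (Γ : Set (S × S))) : ClosedSubgroup S where
  toSubgroup := Γ.map (MonoidHom.fst S S)
  isClosed' := (hΓ.isCompact.image continuous_fst).isClosed

theorem mem_domain [CompactSpace S] [T2Space S] {Γ : Subgroup (S × S)}
    {hΓ : IsClosed (Γ : Set (S × S))} {x : S} : x ∈ domain Γ hΓ ↔ ∃ y, (x, y) ∈ Γ := by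
  constructor
  · rintro ⟨⟨x, y⟩, h, rfl⟩
    exact ⟨y, h⟩
  · rintro ⟨y, h⟩
    exact ⟨(x, y), h, rfl⟩

end ClosedSubgroup

end Graph

/-! ### Calculus of relations and graphs of morphisms in a fusion system -/

namespace Subgroup

variable {G H K : Type*} [Group G] [Group H] [Group K]

/-- The converse of a relation. -/
def converse (Γ : Subgroup (G × H)) : Subgroup (H × G) :=
  Γ.comap (MulEquiv.prodComm : H × G ≃* G × H).toMonoidHom

theorem mem_converse {Γ : Subgroup (G × H)} {x : H} {y : G} :
    (x, y) ∈ Γ.converse ↔ (y, x) ∈ Γ :=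
  Iff.rfl

/-- The composite of two relations. -/
def relComp (Γ : Subgroup (G × H)) (Δ : Subgroup (H × K)) : Subgroup (G × K) where
  carrier := {z | ∃ y, (z.1, y) ∈ Γ ∧ (y, z.2) ∈ Δ}
  one_mem' := ⟨1, one_mem Γ, one_mem Δ⟩
  mul_mem' := by
    rintro _ _ ⟨y, h, h'⟩ ⟨z, k, k'⟩
    exact ⟨y * z, mul_mem h k, mul_mem h' k'⟩
  inv_mem' := by
    rintro _ ⟨y, h, h'⟩
    exact ⟨y⁻¹, inv_mem h, inv_mem h'⟩

theorem mem_relComp {Γ : Subgroup (G × H)} {Δ : Subgroup (H × K)} {x : G} {z : K} :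
    (x, z) ∈ Γ.relComp Δ ↔ ∃ y, (x, y) ∈ Γ ∧ (y, z) ∈ Δ :=
  Iff.rfl

/-- The restriction of a relation to a subgroup. -/
def relRestrict (Γ : Subgroup (G × H)) (P : Subgroup G) : Subgroup (G × H) :=
  Γ ⊓ P.comap (MonoidHom.fst G H)

theorem mem_relRestrict {Γ : Subgroup (G × H)} {P : Subgroup G} {x : G} {y : H} :
    (x, y) ∈ Γ.relRestrict P ↔ (x, y) ∈ Γ ∧ x ∈ P :=
  Iff.rfl

/-- The relation between the elements of `P` and their conjugates with `s`. -/
def conjRel (P : Subgroup G) (s : G) : Subgroup (G × G) :=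
  P.map ((MonoidHom.id G).prod (MulAut.conj s).toMonoidHom)

theorem mem_conjRel {P : Subgroup G} {s x y : G} :
    (x, y) ∈ P.conjRel s ↔ x ∈ P ∧ y = s * x * s⁻¹ := by
  constructor
  · rintro ⟨a, ha, h⟩
    obtain ⟨rfl, rfl⟩ := Prod.ext_iff.1 h
    exact ⟨ha, rfl⟩
  · rintro ⟨h, rfl⟩
    exact ⟨x, h, rfl⟩

theorem isClosed_converse [TopologicalSpace G] [TopologicalSpace H] {Γ : Subgroup (G × H)}
    (hΓ : IsClosed (Γ : Set (G × H))) : IsClosed (Γ.converse : Set (H × G)) :=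
  hΓ.preimage continuous_swap

theorem isClosed_relRestrict [TopologicalSpace G] [TopologicalSpace H] {Γ : Subgroup (G × H)}
    (hΓ : IsClosed (Γ : Set (G × H))) {P : Subgroup G} (hP : IsClosed (P : Set G)) :
    IsClosed (Γ.relRestrict P : Set (G × H)) :=
  hΓ.inter (hP.preimage continuous_fst)

end Subgroup

namespace SubgroupCategory

open ClosedSubgroup
open Subgroup (mem_converse mem_relComp mem_relRestrict mem_conjRel isClosed_converse
  isClosed_relRestrict)

section

variable {S : Type u} [Group S] [TopologicalSpace S] (F : SubgroupCategory S)

/-- `Γ` is the graph of a morphism of `F`. -/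
def IsGraph (Γ : Subgroup (S × S)) : Prop :=
  ∃ P Q : ClosedSubgroup S, ∃ φ ∈ F.Hom P Q, graph φ = Γ

variable {F}

theorem isGraph_of_mem {P Q : ClosedSubgroup S} {φ : P →ₜ* Q} (h : φ ∈ F.Hom P Q) :
    F.IsGraph (graph φ) :=
  ⟨P, Q, φ, h, rfl⟩

theorem mem_hom_congr {P Q P' Q' : ClosedSubgroup S} {φ : P →ₜ* Q} {φ' : P' →ₜ* Q'}
    (h : φ ∈ F.Hom P Q) (hP : P = P') (hQ : Q = Q')
    (hφ : ∀ (a : P) (a' : P'), (a : S) = a' → (φ a : S) = φ' a') : φ' ∈ F.Hom P' Q' := by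
  subst hP hQ
  have : φ = φ' := by
    ext a
    exact hφ a a rfl
  exact this ▸ h

theorem IsGraph.eq_one {Γ : Subgroup (S × S)} (h : F.IsGraph Γ) {y : S} (hy : (1, y) ∈ Γ) :
    y = 1 := by
  obtain ⟨P, Q, φ, -, rfl⟩ := h
  rw [← apply_eq_of_mem_graph (a := (1 : P)) hy, map_one]
  rfl

theorem IsGraph.eq_of_mem {Γ : Subgroup (S × S)} (h : F.IsGraph Γ) {x y y' : S}
    (hy : (x, y) ∈ Γ) (hy' : (x, y') ∈ Γ) : y = y' := by
  have := h.eq_one (y := y * y'⁻¹) (by simpa using mul_mem hy (inv_mem hy'))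
  rwa [mul_inv_eq_one] at this

theorem IsGraph.isClosed [CompactSpace S] [T2Space S] {Γ : Subgroup (S × S)}
    (h : F.IsGraph Γ) : IsClosed (Γ : Set (S × S)) := by
  obtain ⟨P, Q, φ, -, rfl⟩ := h
  exact isClosed_graph φ

variable (hF : F.IsFusionSystem)
include hF

theorem IsFusionSystem.inclusion_mem {P Q : ClosedSubgroup S} (h : P ≤ Q) :
    inclusion h ∈ F.Hom P Q :=
  hF.conj_mem _ 1 fun a => by
    rw [one_mul, inv_one, mul_one]
    rfl

/-- Whether a homomorphism is a morphism depends on its graph only: it factors as an isomorphism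
onto its image and an inclusion, so the codomain can be exchanged. -/
theorem IsFusionSystem.mem_hom_of_isGraph {P Q : ClosedSubgroup S} {φ : P →ₜ* Q}
    (h : F.IsGraph (graph φ)) : φ ∈ F.Hom P Q := by
  obtain ⟨P', Q', φ', hφ', h⟩ := h
  have hP : P' = P := by
    ext x
    constructor
    · intro hx
      have : ((x, φ' ⟨x, hx⟩) : S × S) ∈ graph φ := h ▸ apply_mem_graph φ' ⟨x, hx⟩
      obtain ⟨a, rfl, -⟩ := this
      exact a.2
    · intro hx
      have : ((x, φ ⟨x, hx⟩) : S × S) ∈ graph φ' := h ▸ apply_mem_graph φ ⟨x, hx⟩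
      obtain ⟨a, rfl, -⟩ := this
      exact a.2
  subst hP
  have hv : ∀ a, (φ' a : S) = φ a := fun a => apply_eq_of_mem_graph (h ▸ apply_mem_graph φ a)
  obtain ⟨R, -, ψ, ⟨hψ, ψ', -, -, h2⟩, hψφ⟩ := hF.factor hφ'
  have hR : R ≤ Q := by
    intro b hb
    have : b = φ (ψ' ⟨b, hb⟩) := by rw [← hv, ← hψφ, h2]
    rw [this]
    exact SetLike.coe_mem _
  have := F.comp_mem hψ (hF.inclusion_mem hR)
  refine mem_hom_congr this rfl rfl fun a a' ha => ?_
  rw [← Subtype.ext ha, ← hv, ← hψφ]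
  rfl

theorem IsFusionSystem.converse {Γ : Subgroup (S × S)} (h : F.IsGraph Γ) :
    F.IsGraph Γ.converse := by
  obtain ⟨P, Q, φ, hφ, rfl⟩ := h
  obtain ⟨R, -, ψ, ⟨hψ, ψ', hψ', h1, h2⟩, hψφ⟩ := hF.factor hφ
  refine ⟨R, P, ψ', hψ', ?_⟩
  ext ⟨x, y⟩
  rw [mem_converse]
  constructor
  · rintro ⟨a, rfl, rfl⟩
    exact ⟨ψ' a, rfl, by rw [← hψφ, h2]⟩
  · rintro ⟨a, rfl, rfl⟩
    exact ⟨ψ a, hψφ a, by rw [h1]⟩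

theorem IsFusionSystem.eq_of_mem' {Γ : Subgroup (S × S)} (h : F.IsGraph Γ) {x x' y : S}
    (hx : (x, y) ∈ Γ) (hx' : (x', y) ∈ Γ) : x = x' :=
  (hF.converse h).eq_of_mem (mem_converse.2 hx) (mem_converse.2 hx')

theorem IsFusionSystem.conjRel [IsTopologicalGroup S] (P : ClosedSubgroup S) (s : S) :
    F.IsGraph (P.toSubgroup.conjRel s) := by
  let T : ClosedSubgroup S := ⟨⊤, isClosed_univ⟩
  let φ : P →ₜ* T :=
    { toFun := fun a => ⟨s * a * s⁻¹, trivial⟩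
      map_one' := Subtype.ext (by simp)
      map_mul' := fun a b => Subtype.ext (by simp)
      continuous_toFun := by fun_prop }
  refine ⟨P, T, φ, hF.conj_mem φ s fun a => rfl, ?_⟩
  ext ⟨x, y⟩
  rw [mem_conjRel]
  constructor
  · rintro ⟨a, rfl, rfl⟩
    exact ⟨a.2, rfl⟩
  · rintro ⟨h, rfl⟩
    exact ⟨⟨x, h⟩, rfl, rfl⟩

variable [CompactSpace S] [T2Space S]

theorem IsFusionSystem.mono {Γ Γ' : Subgroup (S × S)} (h : F.IsGraph Γ)
    (hc : IsClosed (Γ' : Set (S × S))) (hle : Γ' ≤ Γ) : F.IsGraph Γ' := by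
  obtain ⟨P, Q, φ, hφ, rfl⟩ := h
  have hP : domain Γ' hc ≤ P := by
    intro x hx
    obtain ⟨y, hy⟩ := mem_domain.1 hx
    obtain ⟨a, ha, -⟩ := hle hy
    exact (show (a : S) = x from ha) ▸ a.2
  refine ⟨domain Γ' hc, Q, _, F.comp_mem (hF.inclusion_mem hP) hφ, ?_⟩
  ext ⟨x, y⟩
  constructor
  · rintro ⟨a, rfl, rfl⟩
    obtain ⟨y, hy⟩ := mem_domain.1 a.2
    have : (φ (inclusion hP a) : S) = y := apply_eq_of_mem_graph (hle hy)
    change ((a : S), (φ (inclusion hP a) : S)) ∈ Γ'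
    rwa [this]
  · intro hxy
    exact ⟨⟨x, mem_domain.2 ⟨y, hxy⟩⟩, rfl,
      apply_eq_of_mem_graph (a := inclusion hP ⟨x, mem_domain.2 ⟨y, hxy⟩⟩) (hle hxy)⟩

theorem IsFusionSystem.relRestrict {Γ : Subgroup (S × S)} (h : F.IsGraph Γ) {P : Subgroup S}
    (hP : IsClosed (P : Set S)) : F.IsGraph (Γ.relRestrict P) :=
  hF.mono h (isClosed_relRestrict h.isClosed hP) inf_le_left

/-- A closed relation which is the graph of a morphism is the graph of a morphism with
prescribed codomain. -/
theorem IsFusionSystem.exists_mem_hom {Γ : Subgroup (S × S)} (h : F.IsGraph Γ)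
    (P Q : ClosedSubgroup S) (hP : ∀ x, x ∈ P ↔ ∃ y, (x, y) ∈ Γ)
    (hQ : ∀ x y, (x, y) ∈ Γ → y ∈ Q) : ∃ φ ∈ F.Hom P Q, graph φ = Γ := by
  obtain ⟨φ, rfl⟩ := exists_graph_eq h.isClosed (fun y => h.eq_one) P Q hP hQ
  exact ⟨φ, hF.mem_hom_of_isGraph h, rfl⟩

/-- The image of the first morphism need not lie in the domain of the second; the first is
restricted to the elements for which the composite makes sense. -/
theorem IsFusionSystem.relComp {Γ Δ : Subgroup (S × S)} (h : F.IsGraph Γ) (h' : F.IsGraph Δ) :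
    F.IsGraph (Γ.relComp Δ) := by
  obtain ⟨P, Q, ψ, hψ, rfl⟩ := h'
  have hc : IsClosed ((Γ ⊓ P.toSubgroup.comap (MonoidHom.snd S S) : Subgroup (S × S)) :
      Set (S × S)) := h.isClosed.inter (P.isClosed'.preimage continuous_snd)
  obtain ⟨φ, hφ, hφΓ⟩ := hF.exists_mem_hom (hF.mono h hc inf_le_left) (domain _ hc) P
    (fun x => mem_domain) fun x y hxy => hxy.2
  refine ⟨_, _, _, F.comp_mem hφ hψ, ?_⟩
  ext ⟨x, z⟩
  constructor
  · rintro ⟨a, rfl, rfl⟩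
    have := apply_mem_graph φ a
    rw [hφΓ] at this
    exact ⟨φ a, this.1, φ a, rfl, rfl⟩
  · rintro ⟨y, hxy, b, hb, rfl⟩
    have hy : y ∈ P := (show (b : S) = y from hb) ▸ b.2
    have : (x, y) ∈ graph φ := by
      rw [hφΓ]
      exact ⟨hxy, hy⟩
    obtain ⟨a, rfl, ha⟩ := this
    refine ⟨a, rfl, ?_⟩
    change (ψ (φ a) : S) = ψ b
    rw [show φ a = b from Subtype.ext (ha.trans hb.symm)]

theorem IsFusionSystem.isIso_iff {P Q : ClosedSubgroup S} {φ : P →ₜ* Q} :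
    F.IsIso φ ↔ φ ∈ F.Hom P Q ∧ ∀ y ∈ Q, ∃ x, (x, y) ∈ graph φ := by
  constructor
  · rintro ⟨h, ψ, -, -, h2⟩
    exact ⟨h, fun y hy => ⟨ψ ⟨y, hy⟩, ψ ⟨y, hy⟩, rfl, by rw [h2]⟩⟩
  · rintro ⟨h, hs⟩
    refine ⟨h, ?_⟩
    obtain ⟨ψ, hψ, hψφ⟩ := hF.exists_mem_hom (hF.converse (isGraph_of_mem h)) Q P
      (fun y => ⟨fun hy => (hs y hy), by
        rintro ⟨x, a, rfl, rfl⟩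
        exact (φ a).2⟩)
      (by
        rintro _ _ ⟨a, rfl, rfl⟩
        exact a.2)
    have h2 : ∀ b, φ (ψ b) = b := fun b => Subtype.ext <| apply_eq_of_mem_graph <| by
      rw [← mem_converse, ← hψφ]
      exact apply_mem_graph ψ b
    exact ⟨ψ, hψ, fun a => hF.injective h (h2 _), h2⟩

end

end SubgroupCategory

theorem Subgroup.map_converse {G H : Type*} [Group G] [Group H] (f : G →* H)
    (Γ : Subgroup (G × G)) :
    Γ.converse.map (f.prodMap f) = (Γ.map (f.prodMap f)).converse := by
  ext ⟨x, y⟩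
  constructor
  · rintro ⟨⟨a, b⟩, h, h'⟩
    exact ⟨(b, a), h, Prod.ext (congrArg Prod.snd h') (congrArg Prod.fst h')⟩
  · rintro ⟨⟨a, b⟩, h, h'⟩
    exact ⟨(b, a), h, Prod.ext (congrArg Prod.snd h') (congrArg Prod.fst h')⟩

theorem Subgroup.mem_map_prodMap {G H : Type*} [Group G] [Group H] {f : G →* H}
    {Γ : Subgroup (G × G)} {x y : H} :
    (x, y) ∈ Γ.map (f.prodMap f) ↔ ∃ a b, (a, b) ∈ Γ ∧ f a = x ∧ f b = y := by
  constructor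
  · rintro ⟨⟨a, b⟩, h, h'⟩
    exact ⟨a, b, h, congrArg Prod.fst h', congrArg Prod.snd h'⟩
  · rintro ⟨a, b, h, rfl, rfl⟩
    exact ⟨(a, b), h, rfl⟩

namespace SubgroupCategory

open ClosedSubgroup
open Subgroup (mem_converse mem_relComp mem_relRestrict mem_conjRel isClosed_converse
  isClosed_relRestrict mem_map_prodMap)

theorem IsMorphism.isGraph_map {S : Type u} [Group S] [TopologicalSpace S] [CompactSpace S]
    {T : Type v} [Group T] [TopologicalSpace T] [T2Space T] {F : SubgroupCategory S}
    {G : SubgroupCategory T} {α : S →ₜ* T} (h : IsMorphism F G α) {Γ : Subgroup (S × S)}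
    (hΓ : F.IsGraph Γ) : G.IsGraph (Γ.map (α.toMonoidHom.prodMap α.toMonoidHom)) := by
  obtain ⟨P, Q, φ, hφ, rfl⟩ := hΓ
  obtain ⟨ψ, hψ, hψφ⟩ := h P Q φ hφ
  refine ⟨_, _, ψ, hψ, ?_⟩
  ext ⟨x, y⟩
  rw [mem_map_prodMap]
  constructor
  · rintro ⟨⟨_, a, ha, rfl⟩, rfl, rfl⟩
    exact ⟨a, φ ⟨a, ha⟩, ⟨⟨a, ha⟩, rfl, rfl⟩, rfl, (hψφ ⟨a, ha⟩).symm⟩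
  · rintro ⟨_, _, ⟨a, rfl, rfl⟩, rfl, rfl⟩
    exact ⟨⟨α a, P.apply_mem_image α a⟩, rfl, hψφ a⟩

end SubgroupCategory

/-! ### Inverse limits of fusion systems in terms of graphs -/

namespace FusionInverseSystem

open SubgroupCategory ClosedSubgroup
open Subgroup (mem_converse mem_relComp mem_relRestrict mem_conjRel isClosed_converse
  isClosed_relRestrict mem_map_prodMap)

variable {p : ℕ} {I : Type w} [PartialOrder I] (D : FusionInverseSystem.{v, w} p I)

/-- The transition homomorphisms of the system. -/
def transition {i j : I} (hij : i ≤ j) : D.grp j →* D.grp i :=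
  (D.map hij).toMonoidHom

theorem mem_lim_hom_iff {P Q : ClosedSubgroup D.Lim} {φ : P →ₜ* Q} :
    φ ∈ D.lim.Hom P Q ↔ ∀ i, (D.fus i).IsGraph
      ((graph φ).map ((D.proj i).toMonoidHom.prodMap (D.proj i).toMonoidHom)) := by
  refine forall_congr' fun i => ?_
  constructor
  · rintro ⟨f, hf, hfφ⟩
    refine ⟨_, _, f, hf, ?_⟩
    ext ⟨x, y⟩
    rw [mem_map_prodMap]
    constructor
    · rintro ⟨⟨_, a, ha, rfl⟩, rfl, rfl⟩
      exact ⟨a, φ ⟨a, ha⟩, ⟨⟨a, ha⟩, rfl, rfl⟩, rfl, (hfφ ⟨a, ha⟩).symm⟩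
    · rintro ⟨_, _, ⟨a, rfl, rfl⟩, rfl, rfl⟩
      exact ⟨⟨D.proj i a, P.apply_mem_image _ a⟩, rfl, hfφ a⟩
  · intro h
    obtain ⟨f, hf, hfφ⟩ := (D.isFusionSystem i).exists_mem_hom h (P.image (D.proj i))
      (Q.image (D.proj i)) (fun x => by
        constructor
        · rintro ⟨a, ha, rfl⟩
          exact ⟨D.proj i (φ ⟨a, ha⟩), mem_map_prodMap.2
            ⟨a, φ ⟨a, ha⟩, ⟨⟨a, ha⟩, rfl, rfl⟩, rfl, rfl⟩⟩
        · rintro ⟨y, h⟩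
          obtain ⟨_, _, ⟨a, rfl, rfl⟩, rfl, rfl⟩ := mem_map_prodMap.1 h
          exact P.apply_mem_image _ a)
      (fun x y h => by
        obtain ⟨_, _, ⟨a, rfl, rfl⟩, rfl, rfl⟩ := mem_map_prodMap.1 h
        exact Q.apply_mem_image _ (φ a))
    refine ⟨f, hf, fun a => apply_eq_of_mem_graph ?_⟩
    rw [hfφ]
    exact mem_map_prodMap.2 ⟨a, φ a, apply_mem_graph φ a, rfl, rfl⟩

end FusionInverseSystem

section

open SubgroupCategory ClosedSubgroup
open Subgroup (mem_converse mem_relComp mem_relRestrict mem_conjRel isClosed_converse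
  isClosed_relRestrict mem_map_prodMap)

variable {p : ℕ} {I : Type w} [PartialOrder I] {S : Type u} [Group S] [TopologicalSpace S]

/-- The category `F` on `S` is, by means of the maps `g i`, the inverse limit of the system
`D`. -/
structure IsFusionLimit (F : SubgroupCategory S) (D : FusionInverseSystem.{v, w} p I)
    (g : ∀ i, S →* D.grp i) : Prop where
  isGroupLimit : IsGroupLimit (H := D.grp) (fun hij => D.transition hij) g
  mem_hom_iff : ∀ {P Q : ClosedSubgroup S} {φ : P →ₜ* Q},
    φ ∈ F.Hom P Q ↔ ∀ i, (D.fus i).IsGraph ((graph φ).map ((g i).prodMap (g i)))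

/-- Absorbs the isomorphism into the projections, so that both presentations of `F` can be used on
the same group `S`. -/
theorem SubgroupCategory.IsIsomorphic.exists_isFusionLimit [CompactSpace S] [T2Space S]
    {F : SubgroupCategory S} {D : FusionInverseSystem.{v, w} p I} (h : IsIsomorphic F D.lim) :
    ∃ g : ∀ i, S →* D.grp i, IsFusionLimit F D g := by
  obtain ⟨e, h1, h2⟩ := h
  refine ⟨fun i => (D.proj i).toMonoidHom.comp (e : S →ₜ* D.Lim).toMonoidHom, ?_, ?_⟩
  · refine ⟨fun i A => ?_, fun {i j} hij a => (e a).2 i j hij, D.map_comp, fun a ha => ?_,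
      fun a ha => ⟨e.symm ⟨a, ha⟩, fun i => ?_⟩⟩
    · exact ((isClosed_discrete A).preimage (D.proj i).continuous_toFun).preimage
        (e : S →ₜ* D.Lim).continuous_toFun
    · have : e a = 1 := Subtype.ext (funext ha)
      exact (map_eq_one_iff e e.injective).1 this
    · change D.proj i (e (e.symm ⟨a, ha⟩)) = a i
      rw [ContinuousMulEquiv.apply_symm_apply]
      rfl
  · intro P Q φ
    constructor
    · intro hφ i
      obtain ⟨ψ, hψ, hψφ⟩ := h1 P Q φ hφ
      convert D.mem_lim_hom_iff.1 hψ i using 1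
      ext ⟨x, y⟩
      rw [mem_map_prodMap, mem_map_prodMap]
      constructor
      · rintro ⟨_, _, ⟨a, rfl, rfl⟩, rfl, rfl⟩
        exact ⟨_, _, ⟨⟨e a, P.apply_mem_image _ a⟩, rfl, rfl⟩, rfl,
          congrArg (D.proj i) (hψφ a)⟩
      · rintro ⟨_, _, ⟨⟨_, a, ha, rfl⟩, rfl, rfl⟩, rfl, rfl⟩
        exact ⟨_, _, ⟨⟨a, ha⟩, rfl, rfl⟩, rfl, congrArg (D.proj i) (hψφ ⟨a, ha⟩).symm⟩
    · intro hφ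
      let α : S →* D.Lim := (e : S →ₜ* D.Lim).toMonoidHom
      have hα : ∀ a, α a = e a := fun _ => rfl
      have hcl : IsClosed (((graph φ).map (α.prodMap α) : Subgroup (D.Lim × D.Lim)) :
          Set (D.Lim × D.Lim)) :=
        ((isClosed_graph φ).isCompact.image ((e : S →ₜ* D.Lim).continuous_toFun.prodMap
          (e : S →ₜ* D.Lim).continuous_toFun)).isClosed
      obtain ⟨ψ, hψ⟩ := exists_graph_eq hcl
        (fun y hy => by
          obtain ⟨_, _, ⟨a, rfl, rfl⟩, ha, rfl⟩ := mem_map_prodMap.1 hy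
          rw [show a = 1 from Subtype.ext ((map_eq_one_iff e e.injective).1 ha), map_one]
          exact map_one α)
        (P.image (e : S →ₜ* D.Lim)) (Q.image (e : S →ₜ* D.Lim))
        (fun x => by
          constructor
          · rintro ⟨a, ha, rfl⟩
            exact ⟨_, mem_map_prodMap.2 ⟨_, _, ⟨⟨a, ha⟩, rfl, rfl⟩, rfl, rfl⟩⟩
          · rintro ⟨y, hy⟩
            obtain ⟨_, _, ⟨a, rfl, rfl⟩, rfl, -⟩ := mem_map_prodMap.1 hy
            exact P.apply_mem_image _ a)
        (fun x y hy => by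
          obtain ⟨_, _, ⟨a, rfl, rfl⟩, -, rfl⟩ := mem_map_prodMap.1 hy
          exact Q.apply_mem_image _ (φ a))
      have hψφ : ∀ a : P, (ψ ⟨e a, P.apply_mem_image _ a⟩ : D.Lim) = e (φ a) := fun a => by
        apply apply_eq_of_mem_graph
        rw [hψ]
        exact mem_map_prodMap.2 ⟨_, _, ⟨a, rfl, rfl⟩, rfl, rfl⟩
      have hψlim : ψ ∈ D.lim.Hom _ _ := D.mem_lim_hom_iff.2 fun i => by
        rw [hψ, Subgroup.map_map]
        exact hφ i
      -- The morphism carried back by `e.symm` lives between the double images of `P` and `Q`. These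
      -- equal `P` and `Q` only propositionally, whence `himg` and `mem_hom_congr`.
      obtain ⟨χ, hχ, hχψ⟩ := h2 _ _ ψ hψlim
      have himg : ∀ P : ClosedSubgroup S,
          (P.image (e : S →ₜ* D.Lim)).image (e.symm : D.Lim →ₜ* S) = P := by
        intro P
        ext x
        constructor
        · rintro ⟨_, ⟨a, ha, rfl⟩, rfl⟩
          change e.symm (e a) ∈ P
          rwa [ContinuousMulEquiv.symm_apply_apply]
        · intro hx
          exact ⟨e x, ⟨x, hx, rfl⟩, e.symm_apply_apply x⟩
      refine mem_hom_congr hχ (himg P) (himg Q) fun a a' ha => ?_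
      have h3 := hχψ ⟨e a', P.apply_mem_image _ a'⟩
      have h4 : a = ⟨e.symm (e a'), apply_mem_image _ _ ⟨e a', P.apply_mem_image _ a'⟩⟩ :=
        Subtype.ext (ha.trans (e.symm_apply_apply _).symm)
      rw [h4]
      refine h3.trans ?_
      rw [hψφ]
      exact e.symm_apply_apply _

namespace IsFusionLimit

variable [CompactSpace S] [T2Space S] {F : SubgroupCategory S}
  {D : FusionInverseSystem.{v, w} p I} {g : ∀ i, S →* D.grp i} (h : IsFusionLimit F D g)
include h

/-- The axioms are tested on graphs level by level, so they pass to the limit and the calculus of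
graphs applies to `F` itself. -/
theorem isFusionSystem : F.IsFusionSystem where
  injective {P Q φ} hφ a b hab := by
    rw [← mul_inv_eq_one]
    apply Subtype.ext
    refine h.isGroupLimit.eq_one _ fun i => ?_
    refine (D.isFusionSystem i).eq_of_mem' (h.mem_hom_iff.1 hφ i) (y := 1)
      (mem_map_prodMap.2 ⟨_, _, apply_mem_graph φ (a * b⁻¹), rfl, ?_⟩) (one_mem _)
    rw [map_mul, map_inv, hab, mul_inv_cancel]
    exact map_one _
  conj_mem {P Q} φ s hφ := h.mem_hom_iff.2 fun i => by
    refine (D.isFusionSystem i).mono ((D.isFusionSystem i).conjRel ⟨⊤, isClosed_univ⟩ (g i s))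
      (isClosed_discrete _) ?_
    rintro ⟨x, y⟩ hxy
    obtain ⟨_, _, ⟨a, rfl, rfl⟩, rfl, rfl⟩ := mem_map_prodMap.1 hxy
    exact mem_conjRel.2 ⟨trivial, by rw [hφ, map_mul, map_mul, map_inv]⟩
  factor {P Q φ} hφ := by
    have hc := isClosed_converse (isClosed_graph φ)
    obtain ⟨R, hR⟩ : ∃ R : ClosedSubgroup S, ∀ x, x ∈ R ↔ ∃ y, (x, y) ∈ (graph φ).converse :=
      ⟨domain _ hc, fun x => mem_domain⟩
    have hRQ : R ≤ Q := by
      intro x hx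
      obtain ⟨_, a, -, rfl⟩ := (hR x).1 hx
      exact (φ a).2
    have h1 : ∀ y, (1, y) ∈ graph φ → y = 1 := by
      intro y hy
      rw [← apply_eq_of_mem_graph (a := (1 : P)) hy, map_one]
      rfl
    obtain ⟨ψ, hψ⟩ := exists_graph_eq (isClosed_graph φ) h1 P R
      (fun x => ⟨fun hx => ⟨_, ⟨x, hx⟩, rfl, rfl⟩, by rintro ⟨y, a, rfl, -⟩; exact a.2⟩)
      fun x y hxy => (hR y).2 ⟨x, hxy⟩
    have hψ' : ψ ∈ F.Hom P R := h.mem_hom_iff.2 fun i => by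
      rw [hψ]
      exact h.mem_hom_iff.1 hφ i
    have hconv : ∀ i, (D.fus i).IsGraph ((graph φ).converse.map ((g i).prodMap (g i))) :=
      fun i => by
        rw [Subgroup.map_converse]
        exact (D.isFusionSystem i).converse (h.mem_hom_iff.1 hφ i)
    obtain ⟨χ, hχ⟩ := exists_graph_eq hc (fun y hy => h.isGroupLimit.eq_one y fun i =>
        (hconv i).eq_one (mem_map_prodMap.2 ⟨_, _, hy, map_one _, rfl⟩)) R P
      hR (by rintro _ _ ⟨a, rfl, rfl⟩; exact a.2)
    have hψφ : ∀ a, (ψ a : S) = φ a := fun a =>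
      apply_eq_of_mem_graph (by
        rw [hψ]
        exact apply_mem_graph φ a)
    refine ⟨R, hRQ, ψ, ⟨hψ', χ, h.mem_hom_iff.2 fun i => ?_,
      fun a => Subtype.ext ?_, fun b => Subtype.ext ?_⟩, hψφ⟩
    · rw [hχ]
      exact hconv i
    · apply apply_eq_of_mem_graph
      rw [hχ, mem_converse, hψφ]
      exact apply_mem_graph φ a
    · apply apply_eq_of_mem_graph
      rw [hψ, ← mem_converse, ← hχ]
      exact apply_mem_graph χ b

omit [CompactSpace S] [T2Space S] in
theorem isGraph_map {Γ : Subgroup (S × S)} (hΓ : F.IsGraph Γ) (i : I) :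
    (D.fus i).IsGraph (Γ.map ((g i).prodMap (g i))) := by
  obtain ⟨P, Q, φ, hφ, rfl⟩ := hΓ
  exact h.mem_hom_iff.1 hφ i

/-- The criterion by which ultralimits of graphs are recognized as morphisms of `F`: that the
relation is a function also follows from the levels, which separate the points of `S`. -/
theorem isGraph_of_map {Γ : Subgroup (S × S)} (hc : IsClosed (Γ : Set (S × S)))
    (hΓ : ∀ i, (D.fus i).IsGraph (Γ.map ((g i).prodMap (g i)))) : F.IsGraph Γ := by
  obtain ⟨φ, hφ⟩ := exists_graph_eq hc (fun y hy => h.isGroupLimit.eq_one y fun i =>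
      (hΓ i).eq_one (mem_map_prodMap.2 ⟨_, _, hy, map_one _, rfl⟩)) (domain _ hc)
    ⟨⊤, isClosed_univ⟩ (fun x => mem_domain) fun _ _ _ => trivial
  exact ⟨_, _, φ, h.mem_hom_iff.2 fun i => by
    rw [hφ]
    exact hΓ i, hφ⟩

end IsFusionLimit

end

/-! ### Conjugates with lexicographically maximal normalizers -/

theorem Subgroup.map_fst_map_prodMap {G H : Type*} [Group G] [Group H] (f : G →* H)
    (Γ : Subgroup (G × G)) :
    (Γ.map (f.prodMap f)).map (MonoidHom.fst H H) = (Γ.map (MonoidHom.fst G G)).map f := by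
  rw [Subgroup.map_map, Subgroup.map_map]
  rfl

theorem Subgroup.map_snd_map_prodMap {G H : Type*} [Group G] [Group H] (f : G →* H)
    (Γ : Subgroup (G × G)) :
    (Γ.map (f.prodMap f)).map (MonoidHom.snd H H) = (Γ.map (MonoidHom.snd G G)).map f := by
  rw [Subgroup.map_map, Subgroup.map_map]
  rfl

theorem Subgroup.mem_map_fst {G H : Type*} [Group G] [Group H] {Γ : Subgroup (G × H)} {x : G} :
    x ∈ Γ.map (MonoidHom.fst G H) ↔ ∃ y, (x, y) ∈ Γ := by
  constructor
  · rintro ⟨⟨x, y⟩, h, rfl⟩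
    exact ⟨y, h⟩
  · rintro ⟨y, h⟩
    exact ⟨(x, y), h, rfl⟩

theorem Subgroup.mem_map_snd {G H : Type*} [Group G] [Group H] {Γ : Subgroup (G × H)} {y : H} :
    y ∈ Γ.map (MonoidHom.snd G H) ↔ ∃ x, (x, y) ∈ Γ := by
  constructor
  · rintro ⟨⟨x, y⟩, h, rfl⟩
    exact ⟨x, h⟩
  · rintro ⟨x, h⟩
    exact ⟨(x, y), h, rfl⟩

theorem Subgroup.isClosed_map_fst {G H : Type*} [Group G] [Group H] [TopologicalSpace G]
    [TopologicalSpace H] [CompactSpace G] [CompactSpace H] [T2Space G] {Γ : Subgroup (G × H)}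
    (hΓ : IsClosed (Γ : Set (G × H))) : IsClosed (Γ.map (MonoidHom.fst G H) : Set G) :=
  (hΓ.isCompact.image continuous_fst).isClosed

theorem Subgroup.isClosed_map_snd {G H : Type*} [Group G] [Group H] [TopologicalSpace G]
    [TopologicalSpace H] [CompactSpace G] [CompactSpace H] [T2Space H] {Γ : Subgroup (G × H)}
    (hΓ : IsClosed (Γ : Set (G × H))) : IsClosed (Γ.map (MonoidHom.snd G H) : Set H) :=
  (hΓ.isCompact.image continuous_snd).isClosed

namespace SubgroupCategory

open ClosedSubgroup
open Subgroup (mem_converse mem_relComp mem_relRestrict mem_conjRel isClosed_converse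
  isClosed_relRestrict mem_map_prodMap map_fst_map_prodMap map_snd_map_prodMap mem_map_fst
  mem_map_snd isClosed_map_fst isClosed_map_snd)

theorem IsFusionSystem.card_map_fst {S : Type u} [Group S] [TopologicalSpace S]
    {F : SubgroupCategory S} (hF : F.IsFusionSystem) {Γ : Subgroup (S × S)} (h : F.IsGraph Γ) :
    Nat.card (Γ.map (MonoidHom.fst S S)) = Nat.card (Γ.map (MonoidHom.snd S S)) := by
  rw [← Nat.card_eq_of_bijective _ ⟨?_, (MonoidHom.fst S S).subgroupMap_surjective Γ⟩,
    ← Nat.card_eq_of_bijective _ ⟨?_, (MonoidHom.snd S S).subgroupMap_surjective Γ⟩]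
  · rintro ⟨⟨x, y⟩, hx⟩ ⟨⟨x', y'⟩, hx'⟩ hxx
    have h2 : y = y' := congrArg Subtype.val hxx
    subst h2
    have := hF.eq_of_mem' h hx hx'
    subst this
    rfl
  · rintro ⟨⟨x, y⟩, hx⟩ ⟨⟨x', y'⟩, hx'⟩ hxx
    have h2 : x = x' := congrArg Subtype.val hxx
    subst h2
    have := h.eq_of_mem hx hx'
    subst this
    rfl

/-- `Q` is the image of `P` under an isomorphism of `F`. -/
def IsConj {S : Type u} [Group S] [TopologicalSpace S] (F : SubgroupCategory S)
    (P Q : Subgroup S) : Prop :=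
  ∃ Γ, F.IsGraph Γ ∧ Γ.map (MonoidHom.fst S S) = P ∧ Γ.map (MonoidHom.snd S S) = Q

theorem IsFusionSystem.isConj_trans {S : Type u} [Group S] [TopologicalSpace S] [CompactSpace S]
    [T2Space S] {F : SubgroupCategory S} (hF : F.IsFusionSystem) {P Q R : Subgroup S}
    (h : F.IsConj P Q) (h' : F.IsConj Q R) : F.IsConj P R := by
  obtain ⟨Γ, hΓ, rfl, rfl⟩ := h
  obtain ⟨Δ, hΔ, h1, rfl⟩ := h'
  refine ⟨_, hF.relComp hΓ hΔ, ?_, ?_⟩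
  · ext x
    rw [mem_map_fst, mem_map_fst]
    constructor
    · rintro ⟨z, y, h, -⟩
      exact ⟨y, h⟩
    · rintro ⟨y, h⟩
      have : y ∈ Δ.map (MonoidHom.fst S S) := h1 ▸ mem_map_snd.2 ⟨x, h⟩
      obtain ⟨z, hz⟩ := mem_map_fst.1 this
      exact ⟨z, y, h, hz⟩
  · ext z
    rw [mem_map_snd, mem_map_snd]
    constructor
    · rintro ⟨x, y, -, h⟩
      exact ⟨y, h⟩
    · rintro ⟨y, h⟩
      have : y ∈ Γ.map (MonoidHom.snd S S) := h1 ▸ mem_map_fst.2 ⟨z, h⟩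
      obtain ⟨x, hx⟩ := mem_map_snd.1 this
      exact ⟨x, y, hx, h⟩

end SubgroupCategory

/-- Iterated maximization: the elements of `C` at which `a 0`, ..., `a (n - 1)` are
lexicographically as large as possible. -/
def lexMaximizers {X : Type*} (C : Set X) (a : ℕ → X → ℕ) : ℕ → Set X
  | 0 => C
  | n + 1 => {x ∈ lexMaximizers C a n | ∀ y ∈ lexMaximizers C a n, a n y ≤ a n x}

theorem lexMaximizers_antitone {X : Type*} (C : Set X) (a : ℕ → X → ℕ) :
    Antitone (lexMaximizers C a) :=
  antitone_nat_of_succ_le fun _ _ hx => hx.1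

theorem lexMaximizers_nonempty {X : Type*} {C : Set X} {a : ℕ → X → ℕ} (hC : C.Nonempty)
    (ha : ∀ n, ∃ b, ∀ x, a n x ≤ b) (n : ℕ) : (lexMaximizers C a n).Nonempty := by
  induction n with
  | zero => exact hC
  | succ n ih =>
    obtain ⟨b, hb⟩ := ha n
    have hfin : (a n '' lexMaximizers C a n).Finite :=
      (Set.finite_Iic b).subset (by
        rintro _ ⟨x, -, rfl⟩
        exact hb x)
    obtain ⟨x, hx, hmax⟩ := Set.exists_max_image _ id hfin (ih.image _)
    obtain ⟨x, hx, rfl⟩ := hx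
    exact ⟨x, hx, fun y hy => hmax _ ⟨y, hy, rfl⟩⟩

/-- By induction: the value at `y` bounds the value at `x`, which bounds all others at that stage.
Comparing `x` with `y` at the next stage then forces equality in each coordinate. -/
theorem mem_lexMaximizers_of_le {X : Type*} {C : Set X} {a : ℕ → X → ℕ} {x y : X} (hy : y ∈ C)
    (hx : ∀ n, x ∈ lexMaximizers C a n) (h : ∀ n, a n x ≤ a n y) (n : ℕ) :
    y ∈ lexMaximizers C a n := by
  induction n with
  | zero => exact hy
  | succ n ih => exact ⟨ih, fun z hz => ((hx (n + 1)).2 z hz).trans (h n)⟩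

namespace IsFusionLimit

open SubgroupCategory ClosedSubgroup
open Subgroup (mem_converse mem_relComp mem_relRestrict mem_conjRel isClosed_converse
  isClosed_relRestrict mem_map_prodMap map_fst_map_prodMap map_snd_map_prodMap mem_map_fst
  mem_map_snd isClosed_map_fst isClosed_map_snd)

variable {p : ℕ} {S : Type u} [Group S] [TopologicalSpace S] [CompactSpace S]
  {F : SubgroupCategory S}

theorem eq_of_map_eq {I : Type w} [PartialOrder I] [Nonempty I] [IsDirectedOrder I]
    {D : FusionInverseSystem.{v, w} p I} {g : ∀ i, S →* D.grp i} (h : IsFusionLimit F D g)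
    {A B : Subgroup S} (hA : IsClosed (A : Set S)) (hB : IsClosed (B : Set S))
    (hAB : ∀ i, A.map (g i) = B.map (g i)) : A = B :=
  le_antisymm (h.isGroupLimit.le_of_forall hB fun i => (hAB i).le)
    (h.isGroupLimit.le_of_forall hA fun i => (hAB i).ge)

/-- In a countably based inverse limit of fusion systems, each subgroup has a conjugate `Q` such
that each morphism that is defined on the normalizer of `Q` maps it onto the normalizer of the
image of `Q`. -/
theorem exists_isConj_normalizer_le [T2Space S] [IsTopologicalGroup S]
    {E : FusionInverseSystem.{v, 0} p ℕ}
    {g : ∀ i, S →* E.grp i} (h : IsFusionLimit F E g) (P : ClosedSubgroup S) :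
    ∃ Q : ClosedSubgroup S, F.IsConj P.toSubgroup Q.toSubgroup ∧
      ∀ (R : ClosedSubgroup S) (χ : Subgroup (S × S)), F.IsGraph χ →
        (∀ x ∈ Q.normalizer, ∃ y, (x, y) ∈ χ) → (∀ y, y ∈ R ↔ ∃ x ∈ Q, (x, y) ∈ χ) →
        ∀ y ∈ R.normalizer, ∃ x ∈ Q.normalizer, (x, y) ∈ χ := by
  have hF := h.isFusionSystem
  let C : Set (ClosedSubgroup S) := {Q | F.IsConj P.toSubgroup Q.toSubgroup}
  let a : ℕ → ClosedSubgroup S → ℕ := fun n Q => Nat.card (Q.normalizer.toSubgroup.map (g n))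
  have hmono : ∀ {n} {A B : Subgroup S}, A ≤ B → Nat.card (A.map (g n)) ≤ Nat.card (B.map (g n)) :=
    fun hAB => Subgroup.card_le_of_le (Subgroup.map_mono hAB)
  have hPC : P ∈ C := by
    refine ⟨_, hF.conjRel P 1, ?_, ?_⟩
    · ext x
      simp [mem_conjRel]
    · ext x
      simp [mem_conjRel]
  have hne := lexMaximizers_nonempty (C := C) (a := a) ⟨P, hPC⟩
    fun n => ⟨Nat.card (E.grp n), fun Q => Subgroup.card_le_card_group _⟩
  -- `q n` is maximal for the first `n` orders only; a limit of the `q n` will be maximal for all of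
  -- them.
  choose q hq using hne
  choose Γ hΓ hΓP hΓq using fun n => lexMaximizers_antitone C a (Nat.zero_le n) (hq n)
  let U := Filter.hyperfilter ℕ
  obtain ⟨Γ', hΓ'c, hΓ'⟩ := h.isGroupLimit.prod.exists_ultralimit_of_family U Γ
  obtain ⟨N, hNc, hN⟩ := h.isGroupLimit.exists_ultralimit_of_family U
    fun n => (q n).normalizer.toSubgroup
  have hΓ'F : F.IsGraph Γ' := h.isGraph_of_map hΓ'c fun i => by
    obtain ⟨m, hm⟩ := (hΓ' i).exists
    rw [hm]
    exact h.isGraph_map (hΓ m) i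
  let Q : ClosedSubgroup S := ⟨Γ'.map (MonoidHom.snd S S), isClosed_map_snd hΓ'c⟩
  have hQC : Q ∈ C := by
    refine ⟨Γ', hΓ'F, h.eq_of_map_eq (isClosed_map_fst hΓ'c) P.isClosed' fun i => ?_, rfl⟩
    obtain ⟨m, hm⟩ := (hΓ' i).exists
    rw [← map_fst_map_prodMap, hm, map_fst_map_prodMap, hΓP]
  have hQq : ∀ i, ∀ᶠ m in U, Q.toSubgroup.map (g i) = (q m).toSubgroup.map (g i) := fun i => by
    filter_upwards [hΓ' i] with m hm
    rw [← hΓq, ← map_snd_map_prodMap, hm, map_snd_map_prodMap]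
  have hNQ : N ≤ Q.normalizer.toSubgroup :=
    h.isGroupLimit.le_normalizer_of_forall Q.isClosed' fun i => by
      obtain ⟨m, hm, hm'⟩ := ((hQq i).and (hN i)).exists
      rw [hm, hm']
      exact Subgroup.le_normalizer_map (H := (q m).toSubgroup) _
  have hQ : ∀ n, Q ∈ lexMaximizers C a n := by
    intro n
    induction n with
    | zero => exact hQC
    | succ n ih =>
      refine ⟨ih, fun y hy => ?_⟩
      -- Since `m > n`, the order of the image of `N_S(q m)` at level `n` is already maximal. This
      -- image is that of `N`, and `N` lies in the normalizer of `Q`.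
      obtain ⟨m, hm, hm'⟩ := ((hN n).and
        (Nat.hyperfilter_le_atTop (Filter.eventually_gt_atTop n))).exists
      have h1 := (lexMaximizers_antitone C a (Nat.succ_le_of_lt hm') (hq m)).2 y hy
      refine h1.trans ?_
      change Nat.card ((q m).normalizer.toSubgroup.map (g n)) ≤ _
      rw [← hm]
      exact hmono hNQ
  refine ⟨Q, hQC, fun R χ hχ hχN hR y hy => ?_⟩
  have hχ' := hF.relRestrict hχ Q.normalizer.isClosed'
  have hχ0 := hF.relRestrict hχ Q.isClosed'
  have hQN : Q.toSubgroup ≤ Q.normalizer.toSubgroup := Subgroup.le_normalizer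
  have hRC : R ∈ C := by
    refine hF.isConj_trans hQC ⟨_, hχ0, ?_, ?_⟩
    · ext x
      rw [mem_map_fst]
      exact ⟨fun ⟨y, hy⟩ => hy.2, fun hx => (hχN x (hQN hx)).imp fun y hy => ⟨hy, hx⟩⟩
    · ext y
      rw [mem_map_snd]
      refine Iff.trans ?_ (hR y).symm
      exact exists_congr fun x => and_comm
  -- `M` is the image of `N_S(Q)` under `χ`. It normalizes `R`, and at each level its image has the
  -- same order as that of `N_S(Q)`, because the morphisms of `E.fus n` are injective.
  let M := (χ.relRestrict Q.normalizer.toSubgroup).map (MonoidHom.snd S S)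
  have hMR : M ≤ R.normalizer.toSubgroup := by
    refine Subgroup.le_normalizer_of_conj_mem (Q := R.toSubgroup) fun z hz r hr => ?_
    obtain ⟨x, hxz⟩ := mem_map_snd.1 hz
    obtain ⟨hxz, hx⟩ := mem_relRestrict.1 hxz
    obtain ⟨s, hs, hsr⟩ := (hR r).1 hr
    exact (hR _).2 ⟨x * s * x⁻¹, (Subgroup.mem_normalizer_iff.1 hx s).1 hs,
      mul_mem (mul_mem hxz hsr) (inv_mem hxz)⟩
  have hfst : (χ.relRestrict Q.normalizer.toSubgroup).map (MonoidHom.fst S S) =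
      Q.normalizer.toSubgroup := by
    ext x
    rw [mem_map_fst]
    exact ⟨fun ⟨y, hy⟩ => hy.2, fun hx => (hχN x hx).imp fun y hy => ⟨hy, hx⟩⟩
  have hcard : ∀ n, a n Q = Nat.card (M.map (g n)) := fun n => by
    have := (E.isFusionSystem n).card_map_fst (h.isGraph_map hχ' n)
    rwa [map_fst_map_prodMap, map_snd_map_prodMap, hfst] at this
  have hle : ∀ n, a n Q ≤ a n R := fun n => by
    rw [hcard]
    exact hmono hMR
  -- `R` is conjugate to `Q` and at least as good in each coordinate, so maximality of `Q` makes all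
  -- coordinates equal.
  have hge : ∀ n, a n R ≤ a n Q := fun n =>
    (hQ (n + 1)).2 R (mem_lexMaximizers_of_le hRC hQ hle n)
  have hMR' : M = R.normalizer.toSubgroup :=
    h.eq_of_map_eq (isClosed_map_snd hχ'.isClosed) R.normalizer.isClosed' fun n =>
      Subgroup.eq_of_le_of_card_ge (Subgroup.map_mono hMR) (hcard n ▸ hge n)
  have hyM : y ∈ M := hMR' ▸ hy
  obtain ⟨x, hx, hx'⟩ := mem_map_snd.1 hyM
  exact ⟨x, hx', hx⟩

end IsFusionLimit

/-! ### Receptivity in terms of graphs, and normalizers in saturated finite fusion systems -/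

theorem exists_monoidHom_of_rel {X Y : Type*} [Group X] [Group Y] (r : X → Y → Prop)
    (hex : ∀ x, ∃ y, r x y) (hmul : ∀ {x x' y y'}, r x y → r x' y' → r (x * x') (y * y'))
    (huniq : ∀ {x y y'}, r x y → r x y' → y = y') : ∃ f : X →* Y, ∀ x, r x (f x) := by
  choose f hf using hex
  exact ⟨MonoidHom.mk' f fun a b => huniq (hf (a * b)) (hmul (hf a) (hf b)), hf⟩

theorem Subgroup.mem_normalizer_of_prod {G H : Type*} [Group G] [Group H] {Γ : Subgroup (G × H)}
    {s : G} {t : H} (hst : (s, t) ∈ Subgroup.normalizer (Γ : Set (G × H))) :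
    s ∈ Subgroup.normalizer (Γ.map (MonoidHom.fst G H) : Set G) ∧
      t ∈ Subgroup.normalizer (Γ.map (MonoidHom.snd G H) : Set H) :=
  ⟨Subgroup.le_normalizer_map (MonoidHom.fst G H) ⟨_, hst, rfl⟩,
    Subgroup.le_normalizer_map (MonoidHom.snd G H) ⟨_, hst, rfl⟩⟩

namespace SubgroupCategory

open ClosedSubgroup
open Subgroup (mem_converse mem_relComp mem_relRestrict mem_conjRel isClosed_converse
  isClosed_relRestrict mem_map_prodMap map_fst_map_prodMap map_snd_map_prodMap mem_map_fst
  mem_map_snd isClosed_map_fst isClosed_map_snd)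

section

variable {S : Type u} [Group S] [TopologicalSpace S] {F : SubgroupCategory S}

/-- One direction suffices: if the conjugate of a pair lies in `Γ`, its first component is in the
domain because `s` normalizes the domain, and the second is then determined, `Γ` being a function.
-/
theorem IsGraph.mem_normalizer {Γ : Subgroup (S × S)} (h : F.IsGraph Γ) {s t : S}
    (hs : s ∈ Subgroup.normalizer (Γ.map (MonoidHom.fst S S) : Set S))
    (hst : ∀ x y, (x, y) ∈ Γ → (s * x * s⁻¹, t * y * t⁻¹) ∈ Γ) :
    (s, t) ∈ Subgroup.normalizer (Γ : Set (S × S)) := by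
  refine Subgroup.mem_normalizer_iff.2 fun ⟨x, y⟩ => ⟨hst x y, fun hxy => ?_⟩
  have hx : x ∈ Γ.map (MonoidHom.fst S S) :=
    (Subgroup.mem_normalizer_iff.1 hs x).2 (mem_map_fst.2 ⟨_, hxy⟩)
  obtain ⟨z, hz⟩ := mem_map_fst.1 hx
  have : t * y * t⁻¹ = t * z * t⁻¹ := h.eq_of_mem hxy (hst x z hz)
  rwa [mul_left_cancel (mul_right_cancel this)]

theorem map_fst_graph {P Q : ClosedSubgroup S} (φ : P →ₜ* Q) :
    (graph φ).map (MonoidHom.fst S S) = P.toSubgroup := by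
  ext x
  rw [mem_map_fst]
  constructor
  · rintro ⟨y, a, rfl, -⟩
    exact a.2
  · exact fun hx => ⟨_, ⟨x, hx⟩, rfl, rfl⟩

theorem exists_mem_graph_iff {P Q : ClosedSubgroup S} {φ : P →ₜ* Q} :
    (∀ y ∈ Q, ∃ x, (x, y) ∈ graph φ) ↔ (graph φ).map (MonoidHom.snd S S) = Q.toSubgroup := by
  constructor
  · intro h
    ext y
    rw [mem_map_snd]
    refine ⟨?_, h y⟩
    rintro ⟨x, a, -, rfl⟩
    exact (φ a).2
  · intro h y hy
    exact mem_map_snd.1 (h.ge hy)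

variable [IsTopologicalGroup S] [CompactSpace S] [T2Space S]

/-- The condition that `y` acts on `Q` as `x` acts on `P`, transported by `φ`, says that conjugation
by `(x, y)` preserves the graph. So `N_φ` is a projection of the normalizer of the graph, a
description that passes well to images and limits. -/
theorem mem_extender_iff {P Q : ClosedSubgroup S}
    {φ : P →ₜ* Q} (hφ : φ ∈ F.Hom P Q) (hs : (graph φ).map (MonoidHom.snd S S) = Q.toSubgroup)
    {x : S} : x ∈ extender φ ↔ ∃ y, (x, y) ∈ Subgroup.normalizer (graph φ : Set (S × S)) := by
  constructor
  · rintro ⟨hx, y, hy, hxy⟩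
    refine ⟨y, (isGraph_of_mem hφ).mem_normalizer ?_ ?_⟩
    · rw [map_fst_graph]
      exact hx
    · rintro _ _ ⟨a, rfl, rfl⟩
      have ha : x * a * x⁻¹ ∈ P := (Subgroup.mem_normalizer_iff.1 hx _).1 a.2
      exact ⟨⟨_, ha⟩, rfl, hxy a ⟨_, ha⟩ rfl⟩
  · rintro ⟨y, hxy⟩
    have h := Subgroup.mem_normalizer_of_prod hxy
    rw [map_fst_graph, hs] at h
    refine ⟨h.1, y, h.2, fun r r' hr => apply_eq_of_mem_graph ?_⟩
    rw [hr]
    exact (Subgroup.mem_normalizer_iff.1 hxy _).1 (apply_mem_graph φ r)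

/-- A description of receptive subgroups in terms of graphs of morphisms. -/
theorem IsFusionSystem.isReceptive_iff (hF : F.IsFusionSystem) {Q : ClosedSubgroup S} :
    F.IsReceptive Q ↔ ∀ Γ, F.IsGraph Γ → Γ.map (MonoidHom.snd S S) = Q.toSubgroup →
      ∃ Δ, F.IsGraph Δ ∧ Γ ≤ Δ ∧ ∀ x y, (x, y) ∈ Subgroup.normalizer (Γ : Set (S × S)) →
        ∃ z, (x, z) ∈ Δ := by
  constructor
  · intro hQ Γ hΓ hΓQ
    obtain ⟨P, hP⟩ : ∃ P : ClosedSubgroup S, ∀ x, x ∈ P ↔ ∃ y, (x, y) ∈ Γ :=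
      ⟨domain Γ hΓ.isClosed, fun x => mem_domain⟩
    obtain ⟨φ, hφ, rfl⟩ := hF.exists_mem_hom hΓ P Q hP
      fun x y hxy => hΓQ.le (mem_map_snd.2 ⟨x, hxy⟩)
    obtain ⟨ψ, hψ, hψφ⟩ := hQ _ φ (hF.isIso_iff.2 ⟨hφ, exists_mem_graph_iff.2 hΓQ⟩)
    refine ⟨_, isGraph_of_mem hψ, ?_, fun x y hxy => ?_⟩
    · rintro ⟨x, y⟩ ⟨a, rfl, rfl⟩
      exact ⟨⟨a, le_extender φ a⟩, rfl, hψφ a⟩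
    · exact ⟨_, ⟨x, (mem_extender_iff hφ hΓQ).2 ⟨y, hxy⟩⟩, rfl, rfl⟩
  · intro h R φ hφ
    rw [hF.isIso_iff, exists_mem_graph_iff] at hφ
    obtain ⟨hφ, hQ⟩ := hφ
    obtain ⟨Δ, hΔ, hφΔ, hN⟩ := h _ (isGraph_of_mem hφ) hQ
    -- If `z` is the image of `x` in `N_φ`, then `z` acts on `Q` like the `y` belonging to `x`, and
    -- therefore normalizes `Q`.
    have hle : (Δ.relRestrict (extender φ).toSubgroup).map (MonoidHom.snd S S) ≤
        Subgroup.normalizer (Q.toSubgroup : Set S) := by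
      refine Subgroup.le_normalizer_of_conj_mem fun z hz q hq => ?_
      obtain ⟨x, hxz⟩ := mem_map_snd.1 hz
      obtain ⟨hxz, hx⟩ := mem_relRestrict.1 hxz
      obtain ⟨y, hxy⟩ := (mem_extender_iff hφ hQ).1 hx
      obtain ⟨u, hu⟩ := exists_mem_graph_iff.2 hQ q hq
      have h1 := mul_mem (mul_mem hxz (hφΔ hu)) (inv_mem hxz)
      have h2 := (Subgroup.mem_normalizer_iff.1 hxy _).1 hu
      have h3 : z * q * z⁻¹ = y * q * y⁻¹ := hΔ.eq_of_mem h1 (hφΔ h2)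
      rw [h3, ← hQ]
      exact mem_map_snd.2 ⟨_, h2⟩
    obtain ⟨ψ, hψ, hψΔ⟩ := hF.exists_mem_hom
      (hF.relRestrict hΔ (extender φ).isClosed') (extender φ) Q.normalizer
      (fun x => ⟨fun hx => by
        obtain ⟨y, hxy⟩ := (mem_extender_iff hφ hQ).1 hx
        exact (hN x y hxy).imp fun z hz => ⟨hz, hx⟩, fun ⟨y, hy⟩ => hy.2⟩)
      fun x y hxy => hle (mem_map_snd.2 ⟨x, hxy⟩)
    refine ⟨ψ, hψ, fun r => apply_eq_of_mem_graph ?_⟩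
    rw [hψΔ]
    exact ⟨hφΔ (apply_mem_graph φ r), le_extender φ r⟩

omit [IsTopologicalGroup S] in
/-- A graph from `Q` onto `Q` gives an automorphism of `Q`. -/
theorem IsFusionSystem.exists_aut (hF : F.IsFusionSystem) {Q : ClosedSubgroup S}
    {Γ : Subgroup (S × S)} (hΓ : F.IsGraph Γ) (h1 : Γ.map (MonoidHom.fst S S) = Q.toSubgroup)
    (h2 : Γ.map (MonoidHom.snd S S) = Q.toSubgroup) :
    ∃ e : F.aut Q, ∀ a : Q, ((a : S), ((e : MulAut Q) a : S)) ∈ Γ := by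
  obtain ⟨φ, hφ, rfl⟩ := hF.exists_mem_hom hΓ Q Q (fun x => by
    rw [← mem_map_fst, h1]
    exact Iff.rfl) fun x y hxy => h2.le (mem_map_snd.2 ⟨x, hxy⟩)
  obtain ⟨-, ψ, hψ, h3, h4⟩ := hF.isIso_iff.2 ⟨hφ, exists_mem_graph_iff.2 h2⟩
  let e : MulAut Q := { toFun := φ, invFun := ψ, left_inv := h3, right_inv := h4,
                        map_mul' := map_mul φ }
  exact ⟨⟨e, ⟨φ, hφ, fun _ => rfl⟩, ψ, hψ, fun _ => rfl⟩, apply_mem_graph φ⟩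

omit [IsTopologicalGroup S] [CompactSpace S] [T2Space S] in
theorem exists_isGraph_of_aut {Q : ClosedSubgroup S} (e : F.aut Q) :
    ∃ Γ, F.IsGraph Γ ∧ ∀ x y, (x, y) ∈ Γ ↔ ∃ a : Q, (a : S) = x ∧ ((e : MulAut Q) a : S) = y := by
  obtain ⟨φ, hφ, he⟩ := e.2.1
  exact ⟨_, isGraph_of_mem hφ, fun x y => exists_congr fun a => by rw [← he]⟩

omit [IsTopologicalGroup S] [CompactSpace S] [T2Space S] in
theorem continuous_aut_apply {Q : ClosedSubgroup S} (a : Q) :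
    Continuous fun e : F.aut Q => (e : MulAut Q) a :=
  have h : Continuous fun f : C(Q, Q) => f a := ContinuousEvalConst.continuous_eval_const a
  h.comp (continuous_induced_dom (f := F.autToMap) (t := ContinuousMap.compactOpen))

end

section

variable {G : Type u} [Group G] [TopologicalSpace G] [DiscreteTopology G] [Finite G]
  {F : SubgroupCategory G}

/-- Makes the trivial subgroup open, so that the pro-`p` Sylow condition reduces to the usual one.
-/
instance discreteTopology_aut (Q : ClosedSubgroup G) : DiscreteTopology (F.aut Q) := by
  rw [discreteTopology_iff_isOpen_singleton]
  intro e
  have : ({e} : Set (F.aut Q)) =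
      ⋂ a : Q, (fun e' : F.aut Q => (e' : MulAut Q) a) ⁻¹' {(e : MulAut Q) a} := by
    ext e'
    simp only [Set.mem_singleton_iff, Set.mem_iInter, Set.mem_preimage]
    exact ⟨fun h _ => by rw [h], fun h => Subtype.ext (MulEquiv.ext h)⟩
  rw [this]
  exact isOpen_iInter_of_finite fun a => (isOpen_discrete _).preimage (continuous_aut_apply a)

/-- In a saturated fusion system on a finite `p`-group, each subgroup `A` has a fully normalized
conjugate `B` such that the normalizer of `A` is mapped to that of `B` by a morphism which maps
`A` to `B`. -/
theorem IsSaturated.exists_normalizer_map {p : ℕ} [Fact p.Prime] (hG : IsPGroup p G)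
    (hF : F.IsFusionSystem) (h : F.IsSaturated p) (A : Subgroup G) :
    ∃ (B : ClosedSubgroup G) (χ : Subgroup (G × G)), F.IsGraph χ ∧
      χ.map (MonoidHom.fst G G) = Subgroup.normalizer (A : Set G) ∧
      (χ.relRestrict A).map (MonoidHom.snd G G) = B.toSubgroup ∧
      F.IsReceptive B ∧ ¬ p ∣ (F.autInner B).index := by
  obtain ⟨B, ⟨φ, hφ⟩, hrec, haut⟩ := h ⟨A, isClosed_discrete _⟩
  rw [hF.isIso_iff, exists_mem_graph_iff] at hφ
  obtain ⟨hφ, hφB⟩ := hφ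
  have hΓ := isGraph_of_mem hφ
  have hΓA := map_fst_graph φ
  change _ = A at hΓA
  have hA : ∀ u, u ∈ A ↔ ∃ v, (u, v) ∈ graph φ := fun u => by rw [← mem_map_fst, hΓA]
  have hB : ∀ v, v ∈ B ↔ ∃ u, (u, v) ∈ graph φ := fun v => by
    rw [← mem_map_snd, hφB]
    exact Iff.rfl
  have hindex : ¬ p ∣ (F.autInner B).index := by
    have := haut.not_dvd_index ⊥ inferInstance (isOpen_discrete _)
    rwa [sup_bot_eq] at this
  have hpH : IsPGroup p (F.autInner B) :=
    (haut.isProPGroup.isPGroup_quotient ⊥ (isOpen_discrete _)).of_equiv QuotientGroup.quotientBot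
  refine ⟨B, ?_⟩
  -- `κ` is the conjugation action of `N(A)` on `A`, transported to `B` along `φ`.
  obtain ⟨κ, hκ⟩ : ∃ κ : Subgroup.normalizer (A : Set G) →* F.aut B,
      ∀ (s : Subgroup.normalizer (A : Set G)) (b b' : B) (u : G),
      (u, (b : G)) ∈ graph φ → ((s : G) * u * (s : G)⁻¹, (b' : G)) ∈ graph φ →
      (κ s : MulAut B) b = b' := by
    have hconj : ∀ (s : Subgroup.normalizer (A : Set G)) (b : B), ∃ u, (u, (b : G)) ∈ graph φ ∧
        ∃ b' : B, ((s : G) * u * (s : G)⁻¹, (b' : G)) ∈ graph φ := by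
      intro s b
      obtain ⟨u, hu⟩ := (hB b).1 b.2
      obtain ⟨v, hv⟩ := (hA _).1 ((Subgroup.mem_normalizer_iff.1 s.2 u).1 ((hA u).2 ⟨_, hu⟩))
      exact ⟨u, hu, ⟨v, (hB v).2 ⟨_, hv⟩⟩, hv⟩
    refine exists_monoidHom_of_rel (fun (s : Subgroup.normalizer (A : Set G)) (e : F.aut B) =>
      ∀ (b b' : B) (u : G), (u, (b : G)) ∈ graph φ →
        ((s : G) * u * (s : G)⁻¹, (b' : G)) ∈ graph φ → (e : MulAut B) b = b') ?_ ?_ ?_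
    · intro s
      have hgr := hF.relComp (hF.relComp (hF.converse hΓ)
        (hF.conjRel ⟨A, isClosed_discrete _⟩ s)) hΓ
      have hmem : ∀ v v', (v, v') ∈ ((graph φ).converse.relComp (A.conjRel s)).relComp (graph φ) ↔
          ∃ u, (u, v) ∈ graph φ ∧ ((s : G) * u * (s : G)⁻¹, v') ∈ graph φ := by
        intro v v'
        constructor
        · rintro ⟨u', ⟨u, h1, h2⟩, h3⟩
          obtain ⟨-, rfl⟩ := mem_conjRel.1 h2
          exact ⟨u, h1, h3⟩
        · rintro ⟨u, h1, h2⟩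
          exact ⟨_, ⟨u, h1, mem_conjRel.2 ⟨(hA u).2 ⟨_, h1⟩, rfl⟩⟩, h2⟩
      obtain ⟨e, he⟩ := hF.exists_aut (Q := B) hgr
        (by
          ext v
          rw [mem_map_fst]
          constructor
          · rintro ⟨v', hv⟩
            obtain ⟨u, hu, -⟩ := (hmem v v').1 hv
            exact (hB v).2 ⟨u, hu⟩
          · intro hv
            obtain ⟨u, hu, b', hb'⟩ := hconj s ⟨v, hv⟩
            exact ⟨b', (hmem _ _).2 ⟨u, hu, hb'⟩⟩)
        (by
          ext v
          rw [mem_map_snd]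
          constructor
          · rintro ⟨v', hv⟩
            obtain ⟨u, -, hu⟩ := (hmem v' v).1 hv
            exact (hB v).2 ⟨_, hu⟩
          · intro hv
            obtain ⟨u, hu, b', hb'⟩ := hconj s⁻¹ ⟨v, hv⟩
            refine ⟨b', (hmem _ _).2 ⟨_, hb', ?_⟩⟩
            simpa [mul_assoc] using hu)
      refine ⟨e, fun b b' u hu hu' => Subtype.ext ?_⟩
      obtain ⟨u₁, h1, h2⟩ := (hmem _ _).1 (he b)
      rw [hF.eq_of_mem' hΓ h1 hu] at h2
      exact hΓ.eq_of_mem h2 hu'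
    · intro s s' e e' he he' b b'' u hu hu'
      obtain ⟨u₁, h1, b', h2⟩ := hconj s' b
      obtain rfl := hF.eq_of_mem' hΓ h1 hu
      change (e : MulAut B) ((e' : MulAut B) b) = b''
      rw [he' b b' _ hu h2]
      refine he b' b'' _ h2 ?_
      convert hu' using 2
      simp [mul_assoc]
    · intro s e e' he he'
      refine Subtype.ext (MulEquiv.ext fun b => ?_)
      obtain ⟨u, h1, b', h2⟩ := hconj s b
      rw [he b b' u h1 h2, he' b b' u h1 h2]
  -- The image of `κ` is a `p`-group, so Sylow's theorem moves it into `Aut_S(B)` by conjugation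
  -- with some `α`. Replacing `φ` by its composite with `α` makes `N_φ` contain all of `N(A)`.
  have hK : IsPGroup p κ.range :=
    (hG.to_subgroup _).of_surjective κ.rangeRestrict κ.rangeRestrict_surjective
  obtain ⟨T, hT⟩ := hK.exists_le_sylow
  obtain ⟨α, hα⟩ := MulAction.exists_smul_eq (F.aut B) T (hpH.toSylow hindex)
  have hαH : ∀ s, α * κ s * α⁻¹ ∈ F.autInner B := by
    intro s
    have : α * κ s * α⁻¹ ∈ ((α • T : Sylow p (F.aut B)) : Subgroup (F.aut B)) :=
      ⟨κ s, hT ⟨s, rfl⟩, rfl⟩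
    rw [hα] at this
    exact this
  obtain ⟨Γα, hΓα, hα'⟩ := exists_isGraph_of_aut α
  have hΓ1 := hF.relComp hΓ hΓα
  have hmem : ∀ u w, (u, w) ∈ (graph φ).relComp Γα ↔
      ∃ b : B, (u, (b : G)) ∈ graph φ ∧ ((α : MulAut B) b : G) = w := by
    intro u w
    rw [mem_relComp]
    constructor
    · rintro ⟨v, h1, h2⟩
      obtain ⟨b, rfl, h3⟩ := (hα' _ _).1 h2
      exact ⟨b, h1, h3⟩
    · rintro ⟨b, h1, h2⟩
      exact ⟨b, h1, (hα' _ _).2 ⟨b, rfl, h2⟩⟩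
  have hsnd : ((graph φ).relComp Γα).map (MonoidHom.snd G G) = B.toSubgroup := by
    ext w
    rw [mem_map_snd]
    constructor
    · rintro ⟨u, hu⟩
      obtain ⟨b, -, rfl⟩ := (hmem _ _).1 hu
      exact SetLike.coe_mem _
    · intro hw
      obtain ⟨u, hu⟩ := (hB _).1 (((α : MulAut B)⁻¹ ⟨w, hw⟩).2)
      exact ⟨u, (hmem _ _).2 ⟨_, hu, by rw [MulAut.apply_inv_self]⟩⟩
  have hfst : ((graph φ).relComp Γα).map (MonoidHom.fst G G) = A := by
    ext u
    rw [mem_map_fst, hA]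
    constructor
    · rintro ⟨w, hw⟩
      obtain ⟨b, hb, -⟩ := (hmem _ _).1 hw
      exact ⟨b, hb⟩
    · rintro ⟨v, hv⟩
      exact ⟨_, (hmem _ _).2 ⟨⟨v, (hB v).2 ⟨_, hv⟩⟩, hv, rfl⟩⟩
  obtain ⟨Δ, hΔ, hle, hN⟩ := hF.isReceptive_iff.1 hrec _ hΓ1 hsnd
  -- If `t` induces `α * κ s * α⁻¹` on `B`, then `(s, t)` normalizes the graph of the corrected
  -- isomorphism, so the extension is defined at `s`.
  have hNA : ∀ s ∈ Subgroup.normalizer (A : Set G), ∃ z, (s, z) ∈ Δ := by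
    intro s hs
    obtain ⟨t, ht, hst⟩ := hαH ⟨s, hs⟩
    refine hN s t (hΓ1.mem_normalizer (hfst.symm ▸ hs) fun u w huw => ?_)
    obtain ⟨b, hub, rfl⟩ := (hmem _ _).1 huw
    obtain ⟨v', hv'⟩ := (hA _).1 ((Subgroup.mem_normalizer_iff.1 hs u).1 ((hA u).2 ⟨_, hub⟩))
    have hκs := hκ ⟨s, hs⟩ b ⟨v', (hB v').2 ⟨_, hv'⟩⟩ u hub hv'
    refine (hmem _ _).2 ⟨⟨v', (hB v').2 ⟨_, hv'⟩⟩, hv', ?_⟩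
    rw [← hst, ← hκs]
    change _ = ((α : MulAut B) ((κ ⟨s, hs⟩ : MulAut B) ((α : MulAut B)⁻¹ ((α : MulAut B) b))) : G)
    rw [MulAut.inv_apply_self]
  refine ⟨Δ.relRestrict (Subgroup.normalizer (A : Set G)), hF.relRestrict hΔ (isClosed_discrete _),
    ?_, ?_, hrec, hindex⟩
  · ext s
    rw [mem_map_fst]
    exact ⟨fun ⟨z, hz⟩ => hz.2, fun hs => (hNA s hs).imp fun z hz => ⟨hz, hs⟩⟩
  · rw [← hsnd]
    ext w
    rw [mem_map_snd, mem_map_snd]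
    constructor
    · rintro ⟨u, ⟨huw, -⟩, hu⟩
      obtain ⟨w', hw'⟩ := mem_map_fst.1 (hfst.ge hu)
      exact ⟨u, hΔ.eq_of_mem huw (hle hw') ▸ hw'⟩
    · rintro ⟨u, hu⟩
      have huA : u ∈ A := hfst.le (mem_map_fst.2 ⟨_, hu⟩)
      exact ⟨u, ⟨hle hu, Subgroup.le_normalizer huA⟩, huA⟩

end

end SubgroupCategory

/-! ### Limits of morphisms on normalizers, and receptivity -/

section

open SubgroupCategory ClosedSubgroup
open Subgroup (mem_converse mem_relComp mem_relRestrict mem_conjRel isClosed_converse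
  isClosed_relRestrict mem_map_prodMap map_fst_map_prodMap map_snd_map_prodMap mem_map_fst
  mem_map_snd isClosed_map_fst isClosed_map_snd)

variable {p : ℕ} {I : Type w} [PartialOrder I] {S : Type u} [Group S] [TopologicalSpace S]

/-- For each `j`, the relation `χ j` is the graph of a morphism, defined on the normalizer of the
image of `Q`, that maps this image to `B j`. Along the ultrafilter `U` these graphs converge to
`χ'`, and their restrictions to the images of `Q` converge to `χ₀`, an isomorphism from `Q` to `R`.
Moreover `χ'` maps the normalizer of `Q` onto that of `R`. -/
structure IsNormalizerLimit [IsTopologicalGroup S] (F : SubgroupCategory S)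
    (D : FusionInverseSystem.{v, w} p I) (g : ∀ i, S →* D.grp i) (U : Ultrafilter I)
    (Q R : ClosedSubgroup S) (B : ∀ j, ClosedSubgroup (D.grp j))
    (χ : ∀ j, Subgroup (D.grp j × D.grp j)) (χ' χ₀ : Subgroup (S × S)) : Prop where
  eventually_ge : ∀ k, ∀ᶠ j in (U : Filter I), k ≤ j
  isGraph : ∀ j, (D.fus j).IsGraph (χ j)
  map_fst : ∀ j, (χ j).map (MonoidHom.fst _ _) =
    Subgroup.normalizer (Q.toSubgroup.map (g j) : Set (D.grp j))
  map_snd : ∀ j, ((χ j).relRestrict (Q.toSubgroup.map (g j))).map (MonoidHom.snd _ _) =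
    (B j).toSubgroup
  isGraph_lim : F.IsGraph χ'
  eventually_map_eq : ∀ i, ∀ᶠ j in (U : Filter I), ∃ hij : i ≤ j,
    χ'.map ((g i).prodMap (g i)) = (χ j).map ((D.transition hij).prodMap (D.transition hij))
  isGraph_restrict : F.IsGraph χ₀
  eventually_map_restrict_eq : ∀ i, ∀ᶠ j in (U : Filter I), ∃ hij : i ≤ j,
    χ₀.map ((g i).prodMap (g i)) = ((χ j).relRestrict (Q.toSubgroup.map (g j))).map
      ((D.transition hij).prodMap (D.transition hij))
  le : χ₀ ≤ χ'
  map_fst_restrict : χ₀.map (MonoidHom.fst S S) = Q.toSubgroup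
  map_snd_restrict : χ₀.map (MonoidHom.snd S S) = R.toSubgroup
  exists_of_mem_normalizer : ∀ y ∈ R.normalizer, ∃ x ∈ Q.normalizer, (x, y) ∈ χ'

theorem FusionInverseSystem.isGraph_map (D : FusionInverseSystem.{v, w} p I) {i j : I}
    (hij : i ≤ j) {Γ : Subgroup (D.grp j × D.grp j)} (hΓ : (D.fus j).IsGraph Γ) :
    (D.fus i).IsGraph (Γ.map ((D.transition hij).prodMap (D.transition hij))) :=
  (D.isMorphism hij).isGraph_map hΓ

theorem Subgroup.map_fst_relRestrict {G H : Type*} [Group G] [Group H] {Γ : Subgroup (G × H)}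
    {P : Subgroup G} (h : P ≤ Γ.map (MonoidHom.fst G H)) :
    (Γ.relRestrict P).map (MonoidHom.fst G H) = P := by
  ext x
  rw [mem_map_fst]
  exact ⟨fun ⟨y, hy⟩ => hy.2, fun hx => (mem_map_fst.1 (h hx)).imp fun y hy => ⟨hy, hx⟩⟩

namespace IsFusionLimit

variable [IsTopologicalGroup S] [CompactSpace S] [T2Space S] [Nonempty I] [IsDirectedOrder I]
  {F : SubgroupCategory S} {D : FusionInverseSystem.{v, w} p I} {g : ∀ i, S →* D.grp i}
  (h : IsFusionLimit F D g)
include h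

omit [IsTopologicalGroup S] [CompactSpace S] [T2Space S] [Nonempty I] [IsDirectedOrder I] in
theorem map_map_transition (A : Subgroup S) {i j : I} (hij : i ≤ j) :
    (A.map (g j)).map (D.transition hij) = A.map (g i) := by
  rw [Subgroup.map_map]
  congr 1
  ext a
  exact h.isGroupLimit.map_apply hij a

omit [IsTopologicalGroup S] in
theorem exists_isGraph_limit (U : Ultrafilter I) (hU : ∀ k, ∀ᶠ j in (U : Filter I), k ≤ j)
    {Γ : ∀ j, Subgroup (D.grp j × D.grp j)} (hΓ : ∀ j, (D.fus j).IsGraph (Γ j)) :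
    ∃ Γ', F.IsGraph Γ' ∧ ∀ i, ∀ᶠ j in (U : Filter I), ∃ hij : i ≤ j,
      Γ'.map ((g i).prodMap (g i)) =
        (Γ j).map ((D.transition hij).prodMap (D.transition hij)) := by
  obtain ⟨Γ', hc, hΓ'⟩ := h.isGroupLimit.prod.exists_ultralimit_of_levels U hU Γ
  refine ⟨Γ', h.isGraph_of_map hc fun i => ?_, hΓ'⟩
  obtain ⟨j, hij, hj⟩ := (hΓ' i).exists
  rw [hj]
  exact D.isGraph_map hij (hΓ j)

/-- The maximality of `Q`, in the form `hQ`, meets the saturation of the levels here. `hQ` applies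
to the limit `χ'` because each `χ j` is defined on the normalizer of the image of `Q`, which
contains the image of `N_S(Q)`. -/
theorem exists_isNormalizerLimit [Fact p.Prime] (hD : ∀ i, (D.fus i).IsSaturated p)
    {Q : ClosedSubgroup S}
    (hQ : ∀ (R : ClosedSubgroup S) (χ : Subgroup (S × S)), F.IsGraph χ →
        (∀ x ∈ Q.normalizer, ∃ y, (x, y) ∈ χ) → (∀ y, y ∈ R ↔ ∃ x ∈ Q, (x, y) ∈ χ) →
        ∀ y ∈ R.normalizer, ∃ x ∈ Q.normalizer, (x, y) ∈ χ) :
    ∃ U R B χ χ' χ₀, IsNormalizerLimit F D g U Q R B χ χ' χ₀ ∧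
      (∀ j, (D.fus j).IsReceptive (B j)) ∧ ∀ j, ¬ p ∣ ((D.fus j).autInner (B j)).index := by
  choose B χ hχ hχ1 hχ2 hrec hindex using fun j =>
    (hD j).exists_normalizer_map (D.isPGroup j) (D.isFusionSystem j) (Q.toSubgroup.map (g j))
  let U : Ultrafilter I := Ultrafilter.of Filter.atTop
  have hU : ∀ k, ∀ᶠ j in (U : Filter I), k ≤ j := fun k =>
    Ultrafilter.of_le Filter.atTop (Filter.eventually_ge_atTop k)
  obtain ⟨χ', hχ', hχ'χ⟩ := h.exists_isGraph_limit U hU hχ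
  have hχr : ∀ j, (D.fus j).IsGraph ((χ j).relRestrict (Q.toSubgroup.map (g j))) :=
    fun j => (D.isFusionSystem j).relRestrict (hχ j) (isClosed_discrete _)
  obtain ⟨χ₀, hχ₀, hχ₀χ⟩ := h.exists_isGraph_limit U hU hχr
  have hle : χ₀ ≤ χ' := h.isGroupLimit.prod.le_of_forall hχ'.isClosed fun i => by
    obtain ⟨j, ⟨hij, h1⟩, _, h2⟩ := ((hχ'χ i).and (hχ₀χ i)).exists
    rw [h1, h2]
    exact Subgroup.map_mono inf_le_left
  have hfst₀ : χ₀.map (MonoidHom.fst S S) = Q.toSubgroup :=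
    h.eq_of_map_eq (isClosed_map_fst hχ₀.isClosed) Q.isClosed' fun i => by
      obtain ⟨j, hij, h1⟩ := (hχ₀χ i).exists
      rw [← map_fst_map_prodMap, h1, map_fst_map_prodMap, Subgroup.map_fst_relRestrict,
        h.map_map_transition]
      rw [hχ1]
      exact Subgroup.le_normalizer
  let R : ClosedSubgroup S := ⟨χ₀.map (MonoidHom.snd S S), isClosed_map_snd hχ₀.isClosed⟩
  refine ⟨U, R, B, χ, χ', χ₀, ⟨hU, hχ, hχ1, hχ2, hχ', hχ'χ, hχ₀, hχ₀χ, hle, hfst₀, rfl,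
    hQ R χ' hχ' (fun x hx => ?_) fun y => ?_⟩, hrec, hindex⟩
  · rw [← mem_map_fst]
    refine h.isGroupLimit.mem_of_forall (isClosed_map_fst hχ'.isClosed) fun i => ?_
    obtain ⟨j, hij, h1⟩ := (hχ'χ i).exists
    rw [← map_fst_map_prodMap, h1, map_fst_map_prodMap, hχ1]
    exact ⟨g j x, Subgroup.le_normalizer_map (H := Q.toSubgroup) _ ⟨x, hx, rfl⟩,
      h.isGroupLimit.map_apply hij x⟩
  · constructor
    · intro hy
      obtain ⟨x, hx⟩ := mem_map_snd.1 hy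
      exact ⟨x, hfst₀.le (mem_map_fst.2 ⟨y, hx⟩), hle hx⟩
    · rintro ⟨x, hx, hxy⟩
      obtain ⟨z, hz⟩ := mem_map_fst.1 (hfst₀.ge hx)
      rw [hχ'.eq_of_mem hxy (hle hz)]
      exact mem_map_snd.2 ⟨x, hz⟩

/-- The extension is found at the levels, with `B j` in place of `Q`, and then pulled back from `R`
to `Q` by the inverse of `χ'`. -/
theorem isReceptive_of_isNormalizerLimit {U : Ultrafilter I} {Q R : ClosedSubgroup S}
    {B : ∀ j, ClosedSubgroup (D.grp j)} {χ : ∀ j, Subgroup (D.grp j × D.grp j)}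
    {χ' χ₀ : Subgroup (S × S)} (hN : IsNormalizerLimit F D g U Q R B χ χ' χ₀)
    (hB : ∀ j, (D.fus j).IsReceptive (B j)) : F.IsReceptive Q := by
  have hF := h.isFusionSystem
  refine hF.isReceptive_iff.2 fun Γ hΓ hΓQ => ?_
  have hQ : ∀ {x y}, (x, y) ∈ Γ → y ∈ Q := fun hxy => hΓQ.le (mem_map_snd.2 ⟨_, hxy⟩)
  have hmem : ∀ {j x y}, (x, y) ∈ Γ → ((g j x, g j y) : D.grp j × D.grp j) ∈
      Γ.map ((g j).prodMap (g j)) := fun hxy => mem_map_prodMap.2 ⟨_, _, hxy, rfl, rfl⟩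
  let c : ∀ j, Subgroup (D.grp j × D.grp j) :=
    fun j => (χ j).relRestrict (Q.toSubgroup.map (g j))
  have hc1 : ∀ j, (c j).map (MonoidHom.fst _ _) = Q.toSubgroup.map (g j) := fun j =>
    Subgroup.map_fst_relRestrict (by
      rw [hN.map_fst]
      exact Subgroup.le_normalizer)
  have hsndΓ : ∀ j, (Γ.map ((g j).prodMap (g j))).map (MonoidHom.snd _ _) =
      Q.toSubgroup.map (g j) := fun j => by rw [map_snd_map_prodMap, hΓQ]
  let Γ' : ∀ j, Subgroup (D.grp j × D.grp j) :=
    fun j => (Γ.map ((g j).prodMap (g j))).relComp (c j)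
  have hΓ' : ∀ j, (D.fus j).IsGraph (Γ' j) := fun j =>
    (D.isFusionSystem j).relComp (h.isGraph_map hΓ j)
      ((D.isFusionSystem j).relRestrict (hN.isGraph j) (isClosed_discrete _))
  have hΓ'1 : ∀ j, (Γ' j).map (MonoidHom.fst _ _) =
      (Γ.map ((g j).prodMap (g j))).map (MonoidHom.fst _ _) := fun j => by
    ext x
    rw [mem_map_fst, mem_map_fst]
    constructor
    · rintro ⟨z, y, hy, -⟩
      exact ⟨y, hy⟩
    · rintro ⟨y, hy⟩
      have := (hsndΓ j).le (mem_map_snd.2 ⟨x, hy⟩)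
      rw [← hc1, mem_map_fst] at this
      exact this.imp fun z hz => ⟨y, hy, hz⟩
  have hΓ'2 : ∀ j, (Γ' j).map (MonoidHom.snd _ _) = (B j).toSubgroup := fun j => by
    rw [← hN.map_snd]
    ext z
    rw [mem_map_snd, mem_map_snd]
    constructor
    · rintro ⟨x, y, -, hy⟩
      exact ⟨y, hy⟩
    · rintro ⟨y, hy⟩
      obtain ⟨x, hx⟩ := mem_map_snd.1 ((hsndΓ j).ge hy.2)
      exact ⟨x, y, hx, hy⟩
  choose Δ hΔ hle hext using fun j => (D.isFusionSystem j).isReceptive_iff.1 (hB j) _ (hΓ' j)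
    (hΓ'2 j)
  obtain ⟨Δ', hΔ', hΔ'Δ⟩ := h.exists_isGraph_limit U hN.eventually_ge hΔ
  -- On the domain of `Γ`, the limit `Δ'` of the extensions is `Γ` followed by `χ₀`.
  have hcomp : ∀ {a q r}, (a, q) ∈ Γ → (q, r) ∈ χ₀ → (a, r) ∈ Δ' := by
    intro a q r haq hqr
    refine h.isGroupLimit.prod.mem_of_forall hΔ'.isClosed fun i => ?_
    obtain ⟨j, ⟨hij, h1⟩, _, h2⟩ := ((hN.eventually_map_restrict_eq i).and (hΔ'Δ i)).exists
    obtain ⟨b, hb⟩ := mem_map_fst.1 ((hc1 j).ge ⟨q, hQ haq, rfl⟩)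
    have h3 := hle j (mem_relComp.2 ⟨_, hmem haq, hb⟩)
    have h4 : (g i q, D.transition hij b) ∈ χ₀.map ((g i).prodMap (g i)) := by
      rw [h1]
      exact mem_map_prodMap.2 ⟨_, _, hb, h.isGroupLimit.map_apply hij q, rfl⟩
    have h5 := (h.isGraph_map hN.isGraph_restrict i).eq_of_mem h4
      (mem_map_prodMap.2 ⟨_, _, hqr, rfl, rfl⟩)
    rw [h2]
    exact mem_map_prodMap.2 ⟨_, _, h3, h.isGroupLimit.map_apply hij a, h5⟩
  -- If `(x, y)` normalizes `Γ`, then `g j y` normalizes the image of `Q`, so `χ j` takes it to some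
  -- `w`. The pair `(g j x, w)` normalizes `Γ' j`, hence `Δ j` is defined at `g j x`.
  have hdom : ∀ x y, (x, y) ∈ Subgroup.normalizer (Γ : Set (S × S)) → ∃ z, (x, z) ∈ Δ' := by
    intro x y hxy
    rw [← mem_map_fst]
    refine h.isGroupLimit.mem_of_forall (isClosed_map_fst hΔ'.isClosed) fun i => ?_
    obtain ⟨j, hij, h1⟩ := (hΔ'Δ i).exists
    rw [← map_fst_map_prodMap, h1, map_fst_map_prodMap]
    refine ⟨g j x, mem_map_fst.2 ?_, h.isGroupLimit.map_apply hij x⟩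
    have h2 : (g j x, g j y) ∈ Subgroup.normalizer
        ((Γ.map ((g j).prodMap (g j)) : Subgroup (D.grp j × D.grp j)) :
          Set (D.grp j × D.grp j)) :=
      Subgroup.le_normalizer_map (H := Γ) ((g j).prodMap (g j)) ⟨_, hxy, rfl⟩
    obtain ⟨h3, h4⟩ := Subgroup.mem_normalizer_of_prod h2
    rw [hsndΓ] at h4
    obtain ⟨w, hw⟩ := mem_map_fst.1 ((hN.map_fst j).ge h4)
    refine hext j _ w ((hΓ' j).mem_normalizer ?_ fun a b hab => ?_)
    · rw [hΓ'1]
      exact h3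
    · obtain ⟨q, haq, hqb, hq⟩ := hab
      refine ⟨g j y * q * (g j y)⁻¹, (Subgroup.mem_normalizer_iff.1 h2 _).1 haq,
        mul_mem (mul_mem hw hqb) (inv_mem hw), (Subgroup.mem_normalizer_iff.1 h4 _).1 hq⟩
  refine ⟨Δ'.relComp χ'.converse, hF.relComp hΔ' (hF.converse hN.isGraph_lim), ?_, ?_⟩
  · rintro ⟨a, q⟩ haq
    obtain ⟨r, hr⟩ := mem_map_fst.1 (hN.map_fst_restrict.ge (hQ haq))
    exact ⟨r, hcomp haq hr, hN.le hr⟩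
  · intro x y hxy
    obtain ⟨z, hz⟩ := hdom x y hxy
    let N := (Δ'.relRestrict ((Subgroup.normalizer (Γ : Set (S × S))).map
      (MonoidHom.fst S S))).map (MonoidHom.snd S S)
    -- `Δ'` maps the domain of the normalizer of `Γ` into `N_S(R)`, which is exactly where the
    -- inverse of `χ'` is known to be defined.
    have hNR : N ≤ Subgroup.normalizer (R.toSubgroup : Set S) := by
      refine Subgroup.le_normalizer_of_conj_mem fun z hz r hr => ?_
      obtain ⟨x, hxz⟩ := mem_map_snd.1 hz
      obtain ⟨hxz, hx⟩ := mem_relRestrict.1 hxz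
      obtain ⟨y, hxy⟩ := mem_map_fst.1 hx
      obtain ⟨q, hqr⟩ := mem_map_snd.1 (hN.map_snd_restrict.ge hr)
      obtain ⟨a, haq⟩ := mem_map_snd.1 (hΓQ.ge (hN.map_fst_restrict.le (mem_map_fst.2 ⟨_, hqr⟩)))
      have h1 : (x * a * x⁻¹, y * q * y⁻¹) ∈ Γ := (Subgroup.mem_normalizer_iff.1 hxy _).1 haq
      obtain ⟨r', hr'⟩ := mem_map_fst.1 (hN.map_fst_restrict.ge (hQ h1))
      have h2 : z * r * z⁻¹ = r' := hΔ'.eq_of_mem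
        (mul_mem (mul_mem hxz (hcomp haq hqr)) (inv_mem hxz)) (hcomp h1 hr')
      rw [h2]
      exact hN.map_snd_restrict.le (mem_map_snd.2 ⟨_, hr'⟩)
    obtain ⟨q, -, hq⟩ := hN.exists_of_mem_normalizer z
      (hNR (mem_map_snd.2 ⟨x, hz, mem_map_fst.2 ⟨y, hxy⟩⟩))
    exact ⟨q, z, hz, hq⟩

end IsFusionLimit

end

/-! ### Automorphism groups and full automization -/

section

open SubgroupCategory ClosedSubgroup
open Subgroup (mem_converse mem_relComp mem_relRestrict mem_conjRel isClosed_converse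
  isClosed_relRestrict mem_map_prodMap map_fst_map_prodMap map_snd_map_prodMap mem_map_fst
  mem_map_snd isClosed_map_fst isClosed_map_snd)

namespace SubgroupCategory

/-- A functional relation `K` between `B` and `A` along which all automorphisms of `B` induce
automorphisms of `A` gives a homomorphism of automorphism groups. -/
theorem exists_aut_hom {S : Type u} [Group S] [TopologicalSpace S] {T : Type v} [Group T]
    [TopologicalSpace T] {F : SubgroupCategory S} {E : SubgroupCategory T} {B : ClosedSubgroup S}
    {A : ClosedSubgroup T} (K : Subgroup (T × S))
    (hA : ∀ a ∈ A, ∃ b ∈ B, (a, b) ∈ K) (hK : ∀ a a' b, (a, b) ∈ K → (a', b) ∈ K → a = a')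
    (hex : ∀ e : F.aut B, ∃ e' : E.aut A, ∀ (a : A) (b : B), ((a : T), (b : S)) ∈ K →
      (((e' : MulAut A) a : T), ((e : MulAut B) b : S)) ∈ K) :
    ∃ f : F.aut B →* E.aut A, ∀ e (a : A) (b : B), ((a : T), (b : S)) ∈ K →
      (((f e : MulAut A) a : T), ((e : MulAut B) b : S)) ∈ K := by
  refine exists_monoidHom_of_rel _ hex (fun {e₁ e₂ f₁ f₂} h₁ h₂ a b hab => ?_)
    fun {e f₁ f₂} h₁ h₂ => ?_
  · exact h₁ _ _ (h₂ a b hab)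
  · refine Subtype.ext (MulEquiv.ext fun a => Subtype.ext ?_)
    obtain ⟨b, hb, hab⟩ := hA a a.2
    exact hK _ _ _ (h₁ a ⟨b, hb⟩ hab) (h₂ a ⟨b, hb⟩ hab)

section

variable {S : Type u} [Group S] [TopologicalSpace S] [CompactSpace S] [T2Space S]
  {F : SubgroupCategory S}

omit [CompactSpace S] [T2Space S] in
theorem autToMap_injective {Q : ClosedSubgroup S} :
    Function.Injective (F.autToMap (P := Q)) := fun _ _ he =>
  Subtype.ext (MulEquiv.ext fun a => DFunLike.congr_fun he a)

omit [CompactSpace S] in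
instance t2Space_aut (Q : ClosedSubgroup S) : T2Space (F.aut Q) :=
  T2Space.of_injective_continuous autToMap_injective
    (continuous_induced_dom (t := ContinuousMap.compactOpen))

theorem continuousMul_aut (Q : ClosedSubgroup S) : ContinuousMul (F.aut Q) := by
  have hQ : CompactSpace Q := isCompact_iff_compactSpace.mp Q.isClosed'.isCompact
  have hc : Continuous (F.autToMap (P := Q)) :=
    continuous_induced_dom (t := ContinuousMap.compactOpen)
  refine ⟨continuous_induced_rng.2 ?_⟩
  exact (hc.comp continuous_fst).compCM (hc.comp continuous_snd)

omit [CompactSpace S] [T2Space S] in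
theorem totallyDisconnectedSpace_aut [TotallyDisconnectedSpace S] (Q : ClosedSubgroup S) :
    TotallyDisconnectedSpace (F.aut Q) := by
  have hc : Continuous fun (e : F.aut Q) (a : Q) => (e : MulAut Q) a :=
    continuous_pi continuous_aut_apply
  refine ⟨isTotallyDisconnected_of_image hc.continuousOn (fun e e' he => ?_)
    (isTotallyDisconnected_of_totallyDisconnectedSpace _)⟩
  exact Subtype.ext (MulEquiv.ext fun a => congrFun he a)

/-- The homomorphism from the normalizer of `Q` onto `Aut_S(Q)`. -/
theorem IsFusionSystem.exists_conj_hom [IsTopologicalGroup S] (hF : F.IsFusionSystem)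
    (Q : ClosedSubgroup S) : ∃ c : Q.normalizer →* F.aut Q,
      (∀ s a, ((c s : MulAut Q) a : S) = s * a * (s : S)⁻¹) ∧ c.range = F.autInner Q ∧
      Continuous c := by
  obtain ⟨c, hc⟩ : ∃ c : Q.normalizer →* F.aut Q, ∀ s, ∀ a : Q,
      ((c s : MulAut Q) a : S) = s * a * (s : S)⁻¹ := by
    refine exists_monoidHom_of_rel (fun (s : Q.normalizer) (e : F.aut Q) => ∀ a : Q,
      ((e : MulAut Q) a : S) = s * a * (s : S)⁻¹) (fun s => ?_) (fun {s t e f} he hf a => ?_)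
      fun {s e f} he hf => ?_
    · have hs := Subgroup.mem_normalizer_iff.1 s.2
      obtain ⟨e, he⟩ := hF.exists_aut (Q := Q) (hF.conjRel Q s)
        (by
          ext x
          rw [mem_map_fst]
          simp [mem_conjRel])
        (by
          ext x
          rw [mem_map_snd]
          constructor
          · rintro ⟨y, hy⟩
            obtain ⟨hyQ, rfl⟩ := mem_conjRel.1 hy
            exact (hs y).1 hyQ
          · intro hx
            refine ⟨(s : S)⁻¹ * x * s, mem_conjRel.2 ⟨(hs _).2 ?_, by simp [mul_assoc]⟩⟩
            simpa [mul_assoc] using hx)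
      exact ⟨e, fun a => (mem_conjRel.1 (he a)).2⟩
    · change ((e : MulAut Q) ((f : MulAut Q) a) : S) = _
      rw [he, hf, Subgroup.coe_mul]
      simp [mul_assoc]
    · exact Subtype.ext (MulEquiv.ext fun a => Subtype.ext ((he a).trans (hf a).symm))
  refine ⟨c, hc, ?_, ?_⟩
  · ext e
    constructor
    · rintro ⟨s, rfl⟩
      exact ⟨s, s.2, hc s⟩
    · rintro ⟨s, hs, hse⟩
      exact ⟨⟨s, hs⟩, Subtype.ext (MulEquiv.ext fun a =>
        Subtype.ext ((hc _ a).trans (hse a).symm))⟩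
  · refine continuous_induced_rng.2 (ContinuousMap.continuous_of_continuous_uncurry _ ?_)
    refine continuous_induced_rng.2 ?_
    have : (Subtype.val ∘ Function.uncurry fun (s : Q.normalizer) (a : Q) =>
        (F.autToMap ∘ c) s a) = fun z => (z.1 : S) * z.2 * (z.1 : S)⁻¹ := by
      ext ⟨s, a⟩
      exact hc s a
    rw [this]
    fun_prop

end

end SubgroupCategory

namespace IsFusionLimit

variable {p : ℕ} {I : Type w} [PartialOrder I] {S : Type u} [Group S] [TopologicalSpace S]
  [IsTopologicalGroup S] [CompactSpace S] [T2Space S] [Nonempty I] [IsDirectedOrder I]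
  {F : SubgroupCategory S} {D : FusionInverseSystem.{v, w} p I} {g : ∀ i, S →* D.grp i}
  (h : IsFusionLimit F D g)
include h

omit [IsTopologicalGroup S] in
/-- The automorphisms of `Q` that induce the identity at some level form a base of neighbourhoods
of `1`. -/
theorem exists_forall_mem_of_isOpen {Q : ClosedSubgroup S} {U : Set (F.aut Q)} (hU : IsOpen U)
    (h1 : 1 ∈ U) : ∃ i, ∀ e : F.aut Q, (∀ a : Q, g i ((e : MulAut Q) a) = g i a) → e ∈ U := by
  by_contra! hcon
  choose e he heU using hcon
  -- Automorphisms `e i` outside `U` that induce the identity at level `i` would converge uniformly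
  -- to 1.
  have hlim : Filter.Tendsto (fun i => F.autToMap (e i)) Filter.atTop (nhds (F.autToMap 1)) := by
    refine ContinuousMap.tendsto_nhds_compactOpen.2 fun K hK W hW hKW => ?_
    have hQc : CompactSpace Q := isCompact_iff_compactSpace.mp Q.isClosed'.isCompact
    suffices hs : ∃ i, ∀ a ∈ K, ∀ b : Q, g i a = g i b → b ∈ W by
      obtain ⟨i, hi⟩ := hs
      filter_upwards [Filter.eventually_ge_atTop i] with j hij a ha
      refine hi a ha _ ?_
      rw [← h.isGroupLimit.map_apply hij, ← he j a, h.isGroupLimit.map_apply hij]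
      rfl
    by_contra! hcon
    -- `C i` consists of the pairs from `K` and the complement of `W` with equal images at level
    -- `i`. The intersection over `x` expresses this equality by preimages under `g i`, which are
    -- closed. By compactness a pair lies in all `C i`; its components agree, contradicting `hKW`.
    let C : I → Set (S × S) := fun i => ((Subtype.val '' K) ×ˢ (Subtype.val '' Wᶜ)) ∩
      ⋂ x : D.grp i, ((Prod.fst ⁻¹' (g i ⁻¹' {x}ᶜ)) ∪ (Prod.snd ⁻¹' (g i ⁻¹' {x})))
    have hC : ∀ i z, z ∈ C i ↔ z.1 ∈ Subtype.val '' K ∧ z.2 ∈ Subtype.val '' Wᶜ ∧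
        g i z.1 = g i z.2 := by
      intro i z
      simp only [C, Set.mem_inter_iff, Set.mem_prod, Set.mem_iInter, Set.mem_union,
        Set.mem_preimage, Set.mem_compl_iff, Set.mem_singleton_iff, and_assoc]
      refine and_congr_right fun _ => and_congr_right fun _ => ⟨fun h => ?_, fun h x => ?_⟩
      · exact ((h (g i z.1)).resolve_left fun h' => h' rfl).symm
      · rw [h]
        exact (em _).symm
    have hcl : ∀ i, IsClosed (C i) := fun i => by
      refine IsClosed.inter ?_ (isClosed_iInter fun x => ?_)
      · exact (hK.image continuous_subtype_val).isClosed.prod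
          (hW.isClosed_compl.isCompact.image continuous_subtype_val).isClosed
      · exact ((h.isGroupLimit.isClosed_preimage i _).preimage continuous_fst).union
          ((h.isGroupLimit.isClosed_preimage i _).preimage continuous_snd)
    obtain ⟨z, hz⟩ := IsCompact.nonempty_iInter_of_directed_nonempty_isCompact_isClosed C
      (by
        intro i j
        obtain ⟨k, hik, hjk⟩ := exists_ge_ge i j
        have key : ∀ l, l ≤ k → C k ⊆ C l := by
          intro l hl z hz
          obtain ⟨h1, h2, h3⟩ := (hC k z).1 hz
          refine (hC l z).2 ⟨h1, h2, ?_⟩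
          rw [← h.isGroupLimit.map_apply hl, h3, h.isGroupLimit.map_apply hl]
        exact ⟨k, key i hik, key j hjk⟩)
      (fun i => by
        obtain ⟨a, ha, b, hab, hb⟩ := hcon i
        exact ⟨(a, b), (hC i _).2 ⟨⟨a, ha, rfl⟩, ⟨b, hb, rfl⟩, hab⟩⟩)
      (fun i => (hcl i).isCompact) hcl
    rw [Set.mem_iInter] at hz
    have heq : z.1 * z.2⁻¹ = 1 := h.isGroupLimit.eq_one _ fun i => by
      rw [map_mul, map_inv, ((hC i z).1 (hz i)).2.2, mul_inv_cancel]
    rw [mul_inv_eq_one] at heq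
    obtain ⟨⟨a, ha, haz⟩, ⟨b, hb, hbz⟩, -⟩ := (hC _ z).1 (hz (Classical.arbitrary I))
    have hab : a = b := Subtype.ext (by rw [haz, hbz, heq])
    exact hb (hab ▸ hKW ha)
  have hnhds : U ∈ nhds (1 : F.aut Q) := hU.mem_nhds h1
  rw [nhds_induced] at hnhds
  obtain ⟨V, hV, hVU⟩ := hnhds
  obtain ⟨i, hi⟩ := (hlim.eventually hV).exists
  exact heU i (hVU hi)

/-- `Aut_S(Q)` is a pro-`p` group. -/
theorem isProPGroup_autInner [TotallyDisconnectedSpace S] (Q : ClosedSubgroup S) :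
    IsClosed (F.autInner Q : Set (F.aut Q)) ∧ IsProPGroup p (F.autInner Q) := by
  have hF := h.isFusionSystem
  obtain ⟨c, hc, hrange, hcont⟩ := hF.exists_conj_hom Q
  have hNc : CompactSpace Q.normalizer :=
    isCompact_iff_compactSpace.mp Q.normalizer.isClosed'.isCompact
  have hcompact : IsCompact (F.autInner Q : Set (F.aut Q)) := by
    rw [← hrange]
    exact isCompact_range hcont
  refine ⟨hcompact.isClosed, ?_, isCompact_iff_compactSpace.mp hcompact, ?_, ?_⟩
  · have hmul := continuousMul_aut (F := F) Q
    have hmem : ∀ s, c s ∈ F.autInner Q := fun s => hrange ▸ ⟨s, rfl⟩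
    let c' : Q.normalizer → F.autInner Q := fun s => ⟨c s, hmem s⟩
    have hc' : Continuous c' := hcont.subtype_mk _
    have hsurj : Function.Surjective c' := by
      rintro ⟨e, he⟩
      obtain ⟨s, rfl⟩ : e ∈ c.range := hrange ▸ he
      exact ⟨s, rfl⟩
    have hq : Topology.IsQuotientMap c' := hc'.isClosedMap.isQuotientMap hc' hsurj
    have hmul' : ContinuousMul (F.autInner Q) := (F.autInner Q).toSubmonoid.continuousMul
    have hNt : IsTopologicalGroup Q.normalizer :=
      inferInstanceAs (IsTopologicalGroup Q.normalizer.toSubgroup)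
    -- `Aut_S(Q)` is a quotient of the compact group `N_S(Q)`, from which continuity of the inverse
    -- descends.
    refine { continuous_mul := hmul'.continuous_mul, continuous_inv := hq.continuous_iff.2 ?_ }
    have : (Inv.inv ∘ c') = c' ∘ Inv.inv := by
      funext s
      exact Subtype.ext (map_inv c s).symm
    rw [this]
    exact hc'.comp continuous_inv
  · have := totallyDisconnectedSpace_aut (F := F) Q
    infer_instance
  · intro V hV hVo
    obtain ⟨V', hV', hVV'⟩ := isOpen_induced_iff.1 hVo
    have h1 : (1 : F.aut Q) ∈ V' := by
      have : (1 : F.autInner Q) ∈ Subtype.val ⁻¹' V' := hVV' ▸ one_mem V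
      exact this
    obtain ⟨i, hi⟩ := h.exists_forall_mem_of_isOpen hV' h1
    intro e
    obtain ⟨⟨e, he⟩, rfl⟩ := QuotientGroup.mk_surjective e
    obtain ⟨s, rfl⟩ : e ∈ c.range := hrange ▸ he
    obtain ⟨k, hk⟩ := D.isPGroup i (g i s)
    refine ⟨k, ?_⟩
    rw [← QuotientGroup.mk_pow, QuotientGroup.eq_one_iff]
    have hmem : (⟨c s, he⟩ ^ p ^ k : F.autInner Q) ∈ (V : Set (F.autInner Q)) := by
      rw [← hVV']
      change c s ^ p ^ k ∈ V'
      rw [← map_pow]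
      refine hi _ fun a => ?_
      rw [hc, map_mul, map_mul, map_inv, Subgroup.coe_pow, map_pow, hk]
      simp
    exact hmem

/-- It suffices to work at one level `i` that detects `V`. There `Aut_F(Q)` and `Aut(B j)` are
compared inside the automorphism group of the image of `Q`, through `ρ` and `θ`. -/
theorem isFullyAutomized_of_isNormalizerLimit [TotallyDisconnectedSpace S] {U : Ultrafilter I}
    {Q R : ClosedSubgroup S} {B : ∀ j, ClosedSubgroup (D.grp j)}
    {χ : ∀ j, Subgroup (D.grp j × D.grp j)} {χ' χ₀ : Subgroup (S × S)}
    (hN : IsNormalizerLimit F D g U Q R B χ χ' χ₀)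
    (hB : ∀ j, ¬ p ∣ ((D.fus j).autInner (B j)).index) : F.IsFullyAutomized p Q := by
  have hF := h.isFusionSystem
  obtain ⟨hcl, hpro⟩ := h.isProPGroup_autInner Q
  refine ⟨hcl, hpro, fun V hV hVo hdvd => ?_⟩
  obtain ⟨i, hi⟩ := h.exists_forall_mem_of_isOpen hVo (one_mem V)
  -- `K` is a limit of the normalizers of the `B j`. As the `B j` converge to `R`, it lies in
  -- `N_S(R)`.
  obtain ⟨K, hKc, hK⟩ := h.isGroupLimit.exists_ultralimit_of_levels U hN.eventually_ge
    fun j => (B j).normalizer.toSubgroup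
  let c : ∀ j, Subgroup (D.grp j × D.grp j) :=
    fun j => (χ j).relRestrict (Q.toSubgroup.map (g j))
  have hcF : ∀ j, (D.fus j).IsGraph (c j) := fun j =>
    (D.isFusionSystem j).relRestrict (hN.isGraph j) (isClosed_discrete _)
  have hc1 : ∀ j, (c j).map (MonoidHom.fst _ _) = Q.toSubgroup.map (g j) := fun j =>
    Subgroup.map_fst_relRestrict (by
      rw [hN.map_fst]
      exact Subgroup.le_normalizer)
  have hRB : ∀ i, ∀ᶠ j in (U : Filter I), ∃ hij : i ≤ j,
      R.toSubgroup.map (g i) = (B j).toSubgroup.map (D.transition hij) := fun i => by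
    filter_upwards [hN.eventually_map_restrict_eq i] with j ⟨hij, h1⟩
    refine ⟨hij, ?_⟩
    rw [← hN.map_snd_restrict, ← map_snd_map_prodMap, h1, map_snd_map_prodMap, hN.map_snd]
  have hKR : K ≤ R.normalizer.toSubgroup :=
    h.isGroupLimit.le_normalizer_of_forall R.isClosed' fun i => by
      obtain ⟨j, ⟨hij, h1⟩, _, h2⟩ := ((hRB i).and (hK i)).exists
      rw [h2]
      refine (Subgroup.le_normalizer_map (H := (B j).toSubgroup) _).trans (le_of_eq ?_)
      rw [← h1]
  obtain ⟨j, ⟨hij, hKj⟩, _, hχj⟩ := ((hK i).and (hN.eventually_map_eq i)).exists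
  let A : ClosedSubgroup (D.grp i) := ⟨Q.toSubgroup.map (g i), isClosed_discrete _⟩
  have hAt : A.toSubgroup = (Q.toSubgroup.map (g j)).map (D.transition hij) :=
    (h.map_map_transition _ hij).symm
  have hcB : ∀ {u v}, (u, v) ∈ c j → v ∈ B j := fun huv =>
    (hN.map_snd j).le (mem_map_snd.2 ⟨_, huv⟩)
  have hcQ : ∀ {u v}, (u, v) ∈ c j → u ∈ Q.toSubgroup.map (g j) := fun huv => huv.2
  have hQc : ∀ {u}, u ∈ Q.toSubgroup.map (g j) → ∃ v, (u, v) ∈ c j := fun hu =>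
    mem_map_fst.1 ((hc1 j).ge hu)
  have hBc : ∀ {v}, v ∈ B j → ∃ u, (u, v) ∈ c j := fun hv =>
    mem_map_snd.1 ((hN.map_snd j).ge hv)
  obtain ⟨ρ, hρ⟩ : ∃ ρ : F.aut Q →* (D.fus i).aut A,
      ∀ (e : F.aut Q) (a : A) (b : Q), (a : D.grp i) = g i b →
      ((ρ e : MulAut A) a : D.grp i) = g i ((e : MulAut Q) b) := by
    let L : Subgroup (D.grp i × S) := Q.toSubgroup.map ((g i).prod (MonoidHom.id S))
    have hL : ∀ x y, (x, y) ∈ L ↔ y ∈ Q ∧ x = g i y := by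
      intro x y
      constructor
      · rintro ⟨a, ha, hxy⟩
        obtain ⟨rfl, rfl⟩ := Prod.ext_iff.1 hxy
        exact ⟨ha, rfl⟩
      · rintro ⟨hy, rfl⟩
        exact ⟨y, hy, rfl⟩
    obtain ⟨ρ, hρ⟩ := exists_aut_hom (F := F) (E := D.fus i) (B := Q) (A := A) L
      (by
        rintro _ ⟨b, hb, rfl⟩
        exact ⟨b, hb, (hL _ _).2 ⟨hb, rfl⟩⟩)
      (fun a a' b hab hab' => ((hL _ _).1 hab).2.trans ((hL _ _).1 hab').2.symm)
      (by
        intro e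
        obtain ⟨Γ, hΓ, hΓe⟩ := exists_isGraph_of_aut e
        have hΓ1 : Γ.map (MonoidHom.fst S S) = Q.toSubgroup := by
          ext x
          rw [mem_map_fst]
          constructor
          · rintro ⟨y, hy⟩
            obtain ⟨a, rfl, -⟩ := (hΓe _ _).1 hy
            exact a.2
          · exact fun hx => ⟨_, (hΓe _ _).2 ⟨⟨x, hx⟩, rfl, rfl⟩⟩
        have hΓ2 : Γ.map (MonoidHom.snd S S) = Q.toSubgroup := by
          ext x
          rw [mem_map_snd]
          constructor
          · rintro ⟨y, hy⟩
            obtain ⟨a, -, rfl⟩ := (hΓe _ _).1 hy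
            exact SetLike.coe_mem _
          · exact fun hx => ⟨_, (hΓe _ _).2 ⟨(e : MulAut Q)⁻¹ ⟨x, hx⟩, rfl, by
              rw [MulAut.apply_inv_self]⟩⟩
        have hΓi := h.isGraph_map hΓ i
        obtain ⟨e', he'⟩ := (D.isFusionSystem i).exists_aut (Q := A) hΓi
          (by rw [map_fst_map_prodMap, hΓ1]) (by rw [map_snd_map_prodMap, hΓ2])
        refine ⟨e', fun a b hab => (hL _ _).2 ⟨SetLike.coe_mem _, ?_⟩⟩
        refine hΓi.eq_of_mem (he' a) (mem_map_prodMap.2 ⟨b, _, (hΓe _ _).2 ⟨b, rfl, rfl⟩, ?_, rfl⟩)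
        exact ((hL _ _).1 hab).2.symm)
    exact ⟨ρ, fun e a b hab => ((hL _ _).1 (hρ e a b ((hL _ _).2 ⟨b.2, hab⟩))).2⟩
  -- `θ` transports an automorphism of `B j` along `c j` to the image of `Q` at level `j` and then
  -- projects it to level `i`.
  obtain ⟨θ, hθ⟩ : ∃ θ : (D.fus j).aut (B j) →* (D.fus i).aut A,
      ∀ (e : (D.fus j).aut (B j)) (a : A) (b : B j) u,
      (u, (b : D.grp j)) ∈ c j → (a : D.grp i) = D.transition hij u →
      ∃ u', (u', ((e : MulAut (B j)) b : D.grp j)) ∈ c j ∧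
        ((θ e : MulAut A) a : D.grp i) = D.transition hij u' := by
    let L : Subgroup (D.grp i × D.grp j) :=
      (c j).map ((D.transition hij).prodMap (MonoidHom.id _))
    have hL : ∀ x y, (x, y) ∈ L ↔ ∃ u, (u, y) ∈ c j ∧ x = D.transition hij u := by
      intro x y
      constructor
      · rintro ⟨⟨u, v⟩, huv, hxy⟩
        obtain ⟨rfl, rfl⟩ := Prod.ext_iff.1 hxy
        exact ⟨u, huv, rfl⟩
      · rintro ⟨u, hu, rfl⟩
        exact ⟨(u, y), hu, rfl⟩
    obtain ⟨θ, hθ⟩ := exists_aut_hom (F := D.fus j) (E := D.fus i) (B := B j) (A := A) L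
      (by
        intro a ha
        obtain ⟨u, hu, rfl⟩ := hAt.le ha
        obtain ⟨v, hv⟩ := hQc hu
        exact ⟨v, hcB hv, (hL _ _).2 ⟨u, hv, rfl⟩⟩)
      (by
        intro a a' b hab hab'
        obtain ⟨u, hu, rfl⟩ := (hL _ _).1 hab
        obtain ⟨u', hu', rfl⟩ := (hL _ _).1 hab'
        rw [(D.isFusionSystem j).eq_of_mem' (hcF j) hu hu'])
      (by
        intro e
        obtain ⟨Γ, hΓ, hΓe⟩ := exists_isGraph_of_aut e
        have hΔ := (D.isFusionSystem j).relComp ((D.isFusionSystem j).relComp (hcF j) hΓ)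
          ((D.isFusionSystem j).converse (hcF j))
        have hΔe : ∀ u u', (u, u') ∈ ((c j).relComp Γ).relComp (c j).converse ↔
            ∃ b : B j, (u, (b : D.grp j)) ∈ c j ∧
              (u', ((e : MulAut (B j)) b : D.grp j)) ∈ c j := by
          intro u u'
          constructor
          · rintro ⟨w, ⟨v, huv, hvw⟩, hw⟩
            obtain ⟨b, rfl, rfl⟩ := (hΓe _ _).1 hvw
            exact ⟨b, huv, hw⟩
          · rintro ⟨b, hb, hb'⟩
            exact ⟨_, ⟨_, hb, (hΓe _ _).2 ⟨b, rfl, rfl⟩⟩, hb'⟩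
        have hΔi := D.isGraph_map hij hΔ
        obtain ⟨e', he'⟩ := (D.isFusionSystem i).exists_aut (Q := A) hΔi
          (by
            rw [map_fst_map_prodMap, hAt]
            congr 1
            ext u
            rw [mem_map_fst]
            constructor
            · rintro ⟨u', hu'⟩
              obtain ⟨b, hb, -⟩ := (hΔe _ _).1 hu'
              exact hcQ hb
            · intro hu
              obtain ⟨v, hv⟩ := hQc hu
              obtain ⟨u', hu'⟩ := hBc (((e : MulAut (B j)) ⟨v, hcB hv⟩).2)
              exact ⟨u', (hΔe _ _).2 ⟨⟨v, hcB hv⟩, hv, hu'⟩⟩)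
          (by
            rw [map_snd_map_prodMap, hAt]
            congr 1
            ext u
            rw [mem_map_snd]
            constructor
            · rintro ⟨u', hu'⟩
              obtain ⟨b, -, hb⟩ := (hΔe _ _).1 hu'
              exact hcQ hb
            · intro hu
              obtain ⟨v, hv⟩ := hQc hu
              obtain ⟨u', hu'⟩ := hBc (((e : MulAut (B j))⁻¹ ⟨v, hcB hv⟩).2)
              refine ⟨u', (hΔe _ _).2 ⟨_, hu', ?_⟩⟩
              rwa [MulAut.apply_inv_self])
        refine ⟨e', fun a b hab => ?_⟩
        obtain ⟨u, hu, hau⟩ := (hL _ _).1 hab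
        obtain ⟨u', hu'⟩ := hBc (((e : MulAut (B j)) b).2)
        refine (hL _ _).2 ⟨u', hu', hΔi.eq_of_mem (he' a)
          (mem_map_prodMap.2 ⟨u, u', (hΔe _ _).2 ⟨b, hu, hu'⟩, hau.symm, rfl⟩)⟩)
    exact ⟨θ, fun e a b u hu hau => (hL _ _).1 (hθ e a b ((hL _ _).2 ⟨u, hu, hau⟩))⟩
  have hker : ρ.ker ≤ V := fun e he => hi e fun a => by
    have h1 := hρ e ⟨g i a, a, a.2, rfl⟩ a rfl
    rw [MonoidHom.mem_ker.1 he] at h1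
    exact h1.symm
  -- The automorphism induced by `e` at level `j`, transported along `c j` to `B j`, is a preimage
  -- under `θ` of `ρ e`.
  have hρθ : ρ.range ≤ θ.range := by
    rintro _ ⟨e, rfl⟩
    obtain ⟨Γ, hΓ, hΓe⟩ := exists_isGraph_of_aut e
    have hΓj := h.isGraph_map hΓ j
    have hΓje : ∀ u u', (u, u') ∈ Γ.map ((g j).prodMap (g j)) ↔
        ∃ a : Q, g j a = u ∧ g j ((e : MulAut Q) a) = u' := by
      intro u u'
      rw [mem_map_prodMap]
      constructor
      · rintro ⟨x, y, hxy, rfl, rfl⟩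
        obtain ⟨a, rfl, rfl⟩ := (hΓe _ _).1 hxy
        exact ⟨a, rfl, rfl⟩
      · rintro ⟨a, rfl, rfl⟩
        exact ⟨_, _, (hΓe _ _).2 ⟨a, rfl, rfl⟩, rfl, rfl⟩
    have hΔ := (D.isFusionSystem j).relComp ((D.isFusionSystem j).relComp
      ((D.isFusionSystem j).converse (hcF j)) hΓj) (hcF j)
    have hΔe : ∀ v v', (v, v') ∈ ((c j).converse.relComp (Γ.map ((g j).prodMap (g j)))).relComp
        (c j) ↔ ∃ a : Q, (g j a, v) ∈ c j ∧ (g j ((e : MulAut Q) a), v') ∈ c j := by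
      intro v v'
      constructor
      · rintro ⟨u', ⟨u, huv, huu⟩, hu'⟩
        obtain ⟨a, rfl, rfl⟩ := (hΓje _ _).1 huu
        exact ⟨a, huv, hu'⟩
      · rintro ⟨a, ha, ha'⟩
        exact ⟨_, ⟨_, ha, (hΓje _ _).2 ⟨a, rfl, rfl⟩⟩, ha'⟩
    obtain ⟨f, hf⟩ := (D.isFusionSystem j).exists_aut (Q := B j) hΔ
      (by
        ext v
        rw [mem_map_fst]
        constructor
        · rintro ⟨v', hv⟩
          obtain ⟨a, ha, -⟩ := (hΔe _ _).1 hv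
          exact hcB ha
        · intro hv
          obtain ⟨u, hu⟩ := hBc hv
          obtain ⟨a, ha, rfl⟩ := hcQ hu
          obtain ⟨v', hv'⟩ := hQc (u := g j ((e : MulAut Q) ⟨a, ha⟩)) ⟨_, SetLike.coe_mem _, rfl⟩
          exact ⟨v', (hΔe _ _).2 ⟨⟨a, ha⟩, hu, hv'⟩⟩)
      (by
        ext v
        rw [mem_map_snd]
        constructor
        · rintro ⟨v', hv⟩
          obtain ⟨a, -, ha⟩ := (hΔe _ _).1 hv
          exact hcB ha
        · intro hv
          obtain ⟨u, hu⟩ := hBc hv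
          obtain ⟨a, ha, rfl⟩ := hcQ hu
          obtain ⟨v', hv'⟩ := hQc (u := g j ((e : MulAut Q)⁻¹ ⟨a, ha⟩)) ⟨_, SetLike.coe_mem _, rfl⟩
          refine ⟨v', (hΔe _ _).2 ⟨_, hv', ?_⟩⟩
          rwa [MulAut.apply_inv_self])
    refine ⟨f, Subtype.ext (MulEquiv.ext fun a => Subtype.ext ?_)⟩
    obtain ⟨u, hu, hau⟩ := hAt.le a.2
    obtain ⟨v, huv⟩ := hQc hu
    obtain ⟨u', hu', hθu'⟩ := hθ f a ⟨v, hcB huv⟩ u huv hau.symm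
    obtain ⟨b, hb, hb'⟩ := (hΔe _ _).1 (hf ⟨v, hcB huv⟩)
    have h1 := (D.isFusionSystem j).eq_of_mem' (hcF j) huv hb
    have h2 := (D.isFusionSystem j).eq_of_mem' (hcF j) hu' hb'
    rw [hθu', h2, h.isGroupLimit.map_apply, hρ e a b]
    rw [← hau, h1, h.isGroupLimit.map_apply]
  -- For `y` in the normalizer of `B j`, the choice of `j` gives `k` in `K` with the same image at
  -- level `i`. Since `k` is in `N_S(R)`, it is the image under `χ'` of some `z` in `N_S(Q)`, and
  -- conjugation by `z` induces the same automorphism at level `i`.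
  have hθρ : ((D.fus j).autInner (B j)).map θ ≤ (F.autInner Q).map ρ := by
    rintro _ ⟨e, ⟨y, hy, hye⟩, rfl⟩
    obtain ⟨k, hk, hky⟩ : D.transition hij y ∈ K.map (g i) := hKj.ge ⟨y, hy, rfl⟩
    obtain ⟨z, hz, hzk⟩ := hN.exists_of_mem_normalizer k (hKR hk)
    obtain ⟨conj, hconj, hrange, -⟩ := hF.exists_conj_hom Q
    refine ⟨conj ⟨z, hz⟩, hrange.le ⟨_, rfl⟩,
      Subtype.ext (MulEquiv.ext fun a => Subtype.ext ?_)⟩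
    obtain ⟨_, ⟨b, hb, rfl⟩, hau⟩ := hAt.le a.2
    obtain ⟨v, huv⟩ := hQc (u := g j b) ⟨b, hb, rfl⟩
    obtain ⟨u', hu', hθu'⟩ := hθ e a ⟨v, hcB huv⟩ _ huv hau.symm
    rw [hye] at hu'
    have hL := h.isGraph_map hN.isGraph_lim i
    have hlift : ∀ {u v}, (u, v) ∈ c j → (D.transition hij u, D.transition hij v) ∈
        χ'.map ((g i).prodMap (g i)) := fun huv => by
      rw [hχj]
      exact mem_map_prodMap.2 ⟨_, _, huv.1, rfl, rfl⟩
    have h1 : (g i z, D.transition hij y) ∈ χ'.map ((g i).prodMap (g i)) :=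
      mem_map_prodMap.2 ⟨z, k, hzk, rfl, hky⟩
    have h2 := mul_mem (mul_mem h1 (hlift huv)) (inv_mem h1)
    have h3 := hlift hu'
    rw [map_mul, map_mul, map_inv] at h3
    have h4 : D.transition hij u' = g i z * D.transition hij (g j b) * (g i z)⁻¹ :=
      (D.isFusionSystem i).eq_of_mem' hL h3 h2
    have h5 : (a : D.grp i) = g i b := hau.symm.trans (h.isGroupLimit.map_apply hij b)
    change ((ρ (conj ⟨z, hz⟩) : MulAut A) a : D.grp i) = ((θ e : MulAut A) a : D.grp i)
    rw [hθu', h4, hρ _ a ⟨b, hb⟩ h5, hconj, h.isGroupLimit.map_apply, map_mul, map_mul, map_inv]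
  -- The index for `V` divides that for the smaller `ρ.ker`, which is an index inside `ρ.range`.
  -- Enlarging `ρ.range` to `θ.range` and shrinking the subgroup to the image of the inner
  -- automorphisms of `B j` only multiplies the index, and the result divides the index at `B j`,
  -- prime to `p`.
  have hd1 : (F.autInner Q ⊔ V).index ∣ (F.autInner Q ⊔ ρ.ker).index :=
    Subgroup.index_dvd_of_le (sup_le_sup_left hker _)
  have hd2 : (F.autInner Q ⊔ ρ.ker).index = ((F.autInner Q).map ρ).relIndex ρ.range := by
    have := Subgroup.relIndex_map_map ρ (F.autInner Q) ⊤
    rw [top_sup_eq, Subgroup.relIndex_top_right, ← MonoidHom.range_eq_map] at this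
    exact this.symm
  have hd3 : ((F.autInner Q).map ρ).relIndex ρ.range ∣ ((F.autInner Q).map ρ).relIndex θ.range := by
    have hle : (F.autInner Q).map ρ ≤ ρ.range := Subgroup.map_le_range _ _
    exact Dvd.intro _ (Subgroup.relIndex_mul_relIndex _ _ _ hle hρθ)
  have hd4 : ((F.autInner Q).map ρ).relIndex θ.range ∣
      (((D.fus j).autInner (B j)).map θ).relIndex θ.range :=
    Subgroup.relIndex_dvd_of_le_left _ hθρ
  have hd5 : (((D.fus j).autInner (B j)).map θ).relIndex θ.range ∣
      ((D.fus j).autInner (B j)).index := by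
    rw [MonoidHom.range_eq_map, Subgroup.relIndex_map_map, top_sup_eq, Subgroup.relIndex_top_right]
    exact Subgroup.index_dvd_of_le le_sup_left
  exact hB j (hdvd.trans (hd1.trans (hd2 ▸ hd3.trans (hd4.trans hd5))))

end IsFusionLimit

end

theorem mainTheorem3 (p : ℕ) [Fact p.Prime] {S : Type u} [Group S] [TopologicalSpace S]
    [IsTopologicalGroup S] [CompactSpace S] [T2Space S] [TotallyDisconnectedSpace S]
    (F : SubgroupCategory S)
    (hF : SubgroupCategory.IsCountablyBased.{u, v} p F)
    (hF' : SubgroupCategory.IsProSaturated.{u, w, x} p F) :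
    SubgroupCategory.IsSaturated p F := by
  obtain ⟨E, hE⟩ := hF
  obtain ⟨g, hg⟩ := hE.exists_isFusionLimit
  obtain ⟨I, _, _, _, D, hD, hFD⟩ := hF'
  obtain ⟨f, hf⟩ := hFD.exists_isFusionLimit
  have hfus := hf.isFusionSystem
  intro P
  -- The countable system serves only to choose `Q`. The property `hmax` refers to `F` alone, so it
  -- can be used with the saturated system.
  obtain ⟨Q, ⟨Γ, hΓ, hΓP, hΓQ⟩, hmax⟩ := hg.exists_isConj_normalizer_le P
  obtain ⟨U, R, B, χ, χ', χ₀, hN, hrec, hindex⟩ := hf.exists_isNormalizerLimit hD hmax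
  refine ⟨Q, ?_, hf.isReceptive_of_isNormalizerLimit hN hrec,
    hf.isFullyAutomized_of_isNormalizerLimit hN hindex⟩
  obtain ⟨φ, hφ, rfl⟩ := hfus.exists_mem_hom hΓ P Q (fun x => by
    rw [← Subgroup.mem_map_fst, hΓP]
    exact Iff.rfl) fun x y hxy => hΓQ.le (Subgroup.mem_map_snd.2 ⟨x, hxy⟩)
  exact ⟨φ, hfus.isIso_iff.2 ⟨hφ, SubgroupCategory.exists_mem_graph_iff.2 hΓQ⟩⟩
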